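/- **Setting.** Let $\mathcal X\subset\mathbb R^{d_x}$ be compact, let $\mathcal D=\mathcal X\times\{0,1\}$, and let Lebesgue measure on $\mathcal D$ be Lebesgue measure on $\mathcal X$ times counting measure on $\{0,1\}$. *Data.* Let $\mu$ be a probability distribution on $\mathcal D$ whose marginal $\mu^X$ on $\mathcal X$ is absolutely continuous with respect to Lebesgue measure, and suppose that $p(x)=\mathbb P_\mu(Y=1\mid X=x)$ (a fixed $[0,1]$-valued version) is upper semi-continuous on $\mathcal X$. Let $z_1,z_2,\dots$ be i.i.d. with law $\mu$ and $\mathcal D_n=\{z_1,\dots,z_n\}$. *Loss.* Let $\ell:[0,1]\times[0,1]\to\mathbb R$ be continuous and such that (i) $\ell\ge 0$, and $\ell(y,y')=0$ if and only if $y=y'$; (ii) for each $q\in[0,1]$ the function $y\mapsto q\,\ell(y,1)+(1-q)\,\ell(y,0)$ has a unique minimizer $y_q^*$ on $[0,1]$, and $q\mapsto y^*_q$ is strictly increasing. *Pruning.* A pruning algorithm $\mathcal A$ maps a finite set $Z\subset\mathcal D$ and a level $r\in(0,1]$ to a subset $\mathcal A(Z,r)\subset Z$ having $\lfloor r|Z|\rfloor$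 elements whenever $r|Z|\ge 1$. It is a score-based pruning algorithm (SBPA) with score $g:\mathcal D\to\mathbb R$ if, whenever $0<r<1$, $r|Z|\ge1$ and the scores $g(z)$, $z\in Z$, are distinct, $\mathcal A(Z,r)$ is the set of those $z\in Z$ with $g(z)$ at most the $\lfloor r|Z|\rfloor$-th smallest score. The score $g$ is adapted if it is continuous and all its level sets have Lebesgue measure zero in $\mathcal D$. It depends on the labels if there is $x$ in the support of $\mu^X$ with $g(x,0)\ne g(x,1)$ and $p(x)\in(0,1)$, such that both $(x,0)$ and $(x,1)$ belong to the support of $\mu$. *Networks.* $FFNN^\sigma_{H,K}(R)$ is the family of fully-connected feed-forward networks $y_{out}(\cdot;w):\mathcal X\to[0,1]$ with $H\ge1$ hidden layers of $K$ neurons with activation $\sigma$, an affine scalar output layer, and all weights and biases in $[-R,R]$; its parameter set $\mathcal W$ consists of those weights and biases in $[-R,R]$ for which the output on $\mathcal X$ lies in $[0,1]$. *Consistency and validity.* Put $\mathcal L(w)=\mathbb E_\mu\,\ell(y_{out}(X;w),Y)$, and let $\mathcal L_n^{\mathcal A,r}(w)$ be the average of $\ell(y_{out}(x;w),y)$ over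 $(x,y)\in\mathcal A(\mathcal D_n,r)$. $\mathcal A$ is consistent if for all $r\in(0,1]$ and $w\in\mathcal W$, $\mathcal L_n^{\mathcal A,r}(w)\to\mathcal L(w)$ almost surely. Given an exact training procedure, i.e. parameters $w_n^{\mathcal A,r}\in\operatorname{argmin}_{w\in\mathcal W}\mathcal L_n^{\mathcal A,r}(w)$, $\mathcal A$ is valid if for all $r\in(0,1]$, $\mathcal L(w_n^{\mathcal A,r})-\min_{w\in\mathcal W}\mathcal L(w)\to0$ almost surely. **Statement.** Let $K\ge d_x+2$, and let $\sigma:\mathbb R\to\mathbb R$ be continuous, not a polynomial, and continuously differentiable at some point with nonzero derivative there. Let $\mathcal A$ be an SBPA with an adapted score function $g$. Then there are $R_0>0$ and $H_0\ge1$ such that for all $H\ge H_0$ and $R\ge R_0$, $\mathcal A$ is not consistent on $FFNN^\sigma_{H,K}(R)$. If moreover $g$ depends on the labels, then there are $R_0'>0$ and $H_0'\ge1$ such that for all $H\ge H_0'$ and $R\ge R_0'$, $\mathcal A$ is not valid on $FFNN^\sigma_{H,K}(R)$, whatever the exact training procedure. -/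

import Mathlib

open MeasureTheory Filter Topology Set

noncomputable section

namespace DataPruning

/-- The input space `ℝ^d`. -/
abbrev Input (d : ℕ) := EuclideanSpace ℝ (Fin d)

/-- Input/label pairs. Labels are real numbers; in binary classification they are `0` or `1`. -/
abbrev Sample (d : ℕ) := Input d × ℝ

/-- The data space `X × {0, 1}` of binary classification. -/
def dataSpace {d : ℕ} (X : Set (Input d)) : Set (Sample d) := X ×ˢ ({0, 1} : Set ℝ)

/-- Lebesgue measure on the data space `X × {0, 1}`: Lebesgue measure on `X` times the counting
measure on the two labels. -/
def dataLebesgue {d : ℕ} (X : Set (Input d)) : Measure (Sample d) :=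
  ((volume : Measure (Input d)).restrict X).prod (Measure.dirac (0 : ℝ) + Measure.dirac (1 : ℝ))

/-! ### Data generating processes and losses -/

/-- `μ` is a generating process for binary classification on `X`, and `p` is an upper
semi-continuous version of the conditional probability `x ↦ ℙ(Y = 1 | X = x)`. -/
structure IsBinaryProcess {d : ℕ} (X : Set (Input d)) (μ : Measure (Sample d))
    (p : Input d → ℝ) : Prop where
  concentrated : μ (dataSpace X)ᶜ = 0
  marginal_ac : μ.map Prod.fst ≪ volume
  mem_Icc : ∀ x ∈ X, p x ∈ Icc (0 : ℝ) 1
  usc : UpperSemicontinuousOn p X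
  condProb : ∀ B : Set (Input d), MeasurableSet B →
    μ.real (B ×ˢ ({1} : Set ℝ)) = ∫ x in B, p x ∂(μ.map Prod.fst)

/-- The standing assumptions on the loss `ℓ : [0,1] × [0,1] → ℝ` (first argument: prediction,
second argument: label). Values of `ℓ` outside the unit square are irrelevant. -/
structure IsClassificationLoss (ℓ : ℝ → ℝ → ℝ) : Prop where
  continuousOn : ContinuousOn (Function.uncurry ℓ) (Icc (0 : ℝ) 1 ×ˢ Icc (0 : ℝ) 1)
  nonneg : ∀ y ∈ Icc (0 : ℝ) 1, ∀ y' ∈ Icc (0 : ℝ) 1, 0 ≤ ℓ y y'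
  eq_zero_iff : ∀ y ∈ Icc (0 : ℝ) 1, ∀ y' ∈ Icc (0 : ℝ) 1, (ℓ y y' = 0 ↔ y = y')
  /-- for each `q`, the function `y ↦ q ℓ(y, 1) + (1 - q) ℓ(y, 0)` on `[0,1]` has a unique
  minimizer, and this minimizer is (strictly) increasing with `q` -/
  exists_minimizer : ∃ ystar : ℝ → ℝ, StrictMonoOn ystar (Icc 0 1) ∧
    ∀ q ∈ Icc (0 : ℝ) 1, ystar q ∈ Icc (0 : ℝ) 1 ∧
      ∀ y ∈ Icc (0 : ℝ) 1, y ≠ ystar q →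
        q * ℓ (ystar q) 1 + (1 - q) * ℓ (ystar q) 0 < q * ℓ y 1 + (1 - q) * ℓ y 0

/-! ### Pruning algorithms -/

/-- A data pruning algorithm on the data space `X × {0, 1}`: from a finite data set `Z` and a
compression level `r ∈ (0, 1]` it keeps `⌊r |Z|⌋` elements of `Z`. Nothing is said about the
number of elements kept when `r |Z| < 1`. -/
def IsPruningAlgorithm {d : ℕ} (X : Set (Input d))
    (A : Finset (Sample d) → ℝ → Finset (Sample d)) : Prop :=
  ∀ Z : Finset (Sample d), (Z : Set (Sample d)) ⊆ dataSpace X → ∀ r ∈ Ioc (0 : ℝ) 1,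
    A Z r ⊆ Z ∧ (1 ≤ r * (Z.card : ℝ) → (A Z r).card = ⌊r * (Z.card : ℝ)⌋₊)

/-- The `k`-th order statistic (`1 ≤ k ≤ |Z|`, the first one being the smallest) of the family
`(g z)_{z ∈ Z}`, counted with multiplicity. -/
def orderStatistic {d : ℕ} (g : Sample d → ℝ) (Z : Finset (Sample d)) (k : ℕ) : ℝ :=
  ((Z.val.map g).sort (· ≤ ·)).getD (k - 1) 0

open scoped Classical in
/-- `A` is score-based with score function `g`: it keeps the samples whose score is at most the
`⌊r |Z|⌋`-th order statistic of the scores. This is required of data sets without ties only: with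
ties, that set may have more than `⌊r |Z|⌋` elements, and a pruning algorithm cannot keep it. -/
def IsScoreBased {d : ℕ} (X : Set (Input d)) (g : Sample d → ℝ)
    (A : Finset (Sample d) → ℝ → Finset (Sample d)) : Prop :=
  ∀ Z : Finset (Sample d), (Z : Set (Sample d)) ⊆ dataSpace X →
    InjOn g (Z : Set (Sample d)) → ∀ r ∈ Ioo (0 : ℝ) 1, 1 ≤ r * (Z.card : ℝ) →
      A Z r = Z.filter (fun z => g z ≤ orderStatistic g Z ⌊r * (Z.card : ℝ)⌋₊)

/-- An adapted score function: continuous on the data space, with level sets of Lebesgue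
measure zero. -/
def IsAdapted {d : ℕ} (X : Set (Input d)) (g : Sample d → ℝ) : Prop :=
  ContinuousOn g (dataSpace X) ∧
    ∀ c ∈ g '' dataSpace X, dataLebesgue X {z ∈ dataSpace X | g z = c} = 0

/-- The score function depends on the labels: at some input `x` in the support of the input
distribution the two labels have different scores, `ℙ(Y = 1 | X = x) ∈ (0, 1)`, and both labels
can happen at `x`, in the sense that `(x, 0)` and `(x, 1)` are in the support of `μ`. -/
def DependsOnLabels {d : ℕ} (μ : Measure (Sample d)) (p : Input d → ℝ)
    (g : Sample d → ℝ) : Prop :=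
  ∃ x ∈ (μ.map Prod.fst).support, g (x, 0) ≠ g (x, 1) ∧ p x ∈ Ioo (0 : ℝ) 1 ∧
    ((x, 0) : Sample d) ∈ μ.support ∧ ((x, 1) : Sample d) ∈ μ.support

/-! ### Risks, consistency, validity -/

/-- The generalization error of a model. -/
def risk {d : ℕ} (ℓ : ℝ → ℝ → ℝ) (μ : Measure (Sample d)) (f : Input d → ℝ) : ℝ :=
  ∫ z, ℓ (f z.1) z.2 ∂μ

/-- The empirical loss of a model on a finite data set. -/
def empiricalRisk {d : ℕ} (ℓ : ℝ → ℝ → ℝ) (S : Finset (Sample d)) (f : Input d → ℝ) : ℝ :=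
  (∑ z ∈ S, ℓ (f z.1) z.2) / (S.card : ℝ)

/-- The law of an infinite sequence of independent samples from `μ`. -/
def iidLaw {d : ℕ} (μ : Measure (Sample d)) [IsProbabilityMeasure μ] :
    Measure (ℕ → Sample d) :=
  Measure.infinitePi (fun _ : ℕ => μ)

open scoped Classical in
/-- The data set formed by the first `n` samples. -/
def firstSamples {d : ℕ} (ω : ℕ → Sample d) (n : ℕ) : Finset (Sample d) :=
  (Finset.range n).image ω

/-- The empirical loss `L_n^{A,r}` on the data set pruned at compression level `r`. -/
def prunedRisk {d : ℕ} (ℓ : ℝ → ℝ → ℝ) (A : Finset (Sample d) → ℝ → Finset (Sample d))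
    (r : ℝ) (ω : ℕ → Sample d) (n : ℕ) (f : Input d → ℝ) : ℝ :=
  empiricalRisk ℓ (A (firstSamples ω n) r) f

/-- `A` is consistent (at every compression level) on the models `yout w`, `w ∈ W`. -/
def IsConsistent {d : ℕ} {P : Type*} (ℓ : ℝ → ℝ → ℝ) (μ : Measure (Sample d))
    [IsProbabilityMeasure μ] (yout : P → Input d → ℝ) (W : Set P)
    (A : Finset (Sample d) → ℝ → Finset (Sample d)) : Prop :=
  ∀ r ∈ Ioc (0 : ℝ) 1, ∀ w ∈ W, ∀ᵐ ω ∂(iidLaw μ),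
    Tendsto (fun n => prunedRisk ℓ A r ω n (yout w)) atTop (𝓝 (risk ℓ μ (yout w)))

/-- An exact training procedure: `train r n ω` is the parameter learned from the first `n` samples
of `ω` pruned at compression level `r`; almost surely it minimizes the pruned empirical loss. -/
def IsExactTraining {d : ℕ} {P : Type*} (ℓ : ℝ → ℝ → ℝ) (μ : Measure (Sample d))
    [IsProbabilityMeasure μ] (yout : P → Input d → ℝ) (W : Set P)
    (A : Finset (Sample d) → ℝ → Finset (Sample d))
    (train : ℝ → ℕ → (ℕ → Sample d) → P) : Prop :=
  ∀ r ∈ Ioc (0 : ℝ) 1, ∀ᵐ ω ∂(iidLaw μ), ∀ n : ℕ, train r n ω ∈ W ∧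
    ∀ w ∈ W, prunedRisk ℓ A r ω n (yout (train r n ω)) ≤ prunedRisk ℓ A r ω n (yout w)

/-- The pruning algorithm underlying the procedure `train` is valid (at every compression level):
the performance gap of the learned parameters tends to zero almost surely. -/
def IsValid {d : ℕ} {P : Type*} (ℓ : ℝ → ℝ → ℝ) (μ : Measure (Sample d))
    [IsProbabilityMeasure μ] (yout : P → Input d → ℝ) (W : Set P)
    (train : ℝ → ℕ → (ℕ → Sample d) → P) : Prop :=
  ∀ r ∈ Ioc (0 : ℝ) 1, ∀ᵐ ω ∂(iidLaw μ),
    Tendsto (fun n => risk ℓ μ (yout (train r n ω)) - sInf ((fun w => risk ℓ μ (yout w)) '' W))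
      atTop (𝓝 0)

/-! ### Neural networks -/

/-- The weights and biases of a fully-connected feed-forward network with input dimension `d`,
`H ≥ 1` hidden layers of `K` neurons each, and one output. -/
structure NetParams (d H K : ℕ) where
  /-- weights of the first hidden layer -/
  inW : Matrix (Fin K) (Fin d) ℝ
  /-- biases of the first hidden layer -/
  inB : Fin K → ℝ
  /-- weights of the other hidden layers -/
  hidW : Fin (H - 1) → Matrix (Fin K) (Fin K) ℝ
  /-- biases of the other hidden layers -/
  hidB : Fin (H - 1) → Fin K → ℝ
  /-- weights of the output layer -/
  outW : Fin K → ℝ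
  /-- bias of the output layer -/
  outB : ℝ

/-- The activations of the hidden layer number `i + 1`, for `i < H`. -/
def NetParams.hidden {d H K : ℕ} (σ : ℝ → ℝ) (w : NetParams d H K) (x : Input d) :
    ℕ → Fin K → ℝ
  | 0 => fun k => σ ((w.inW.mulVec x.ofLp) k + w.inB k)
  | i + 1 =>
    if h : i < H - 1 then
      fun k => σ (((w.hidW ⟨i, h⟩).mulVec (w.hidden σ x i)) k + w.hidB ⟨i, h⟩ k)
    else w.hidden σ x i

/-- The output of the network: an affine function of the last hidden layer. -/
def NetParams.eval {d H K : ℕ} (σ : ℝ → ℝ) (w : NetParams d H K) (x : Input d) : ℝ :=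
  (∑ k, w.outW k * w.hidden σ x (H - 1) k) + w.outB

/-- All weights and biases are in `[-R, R]`. -/
def NetParams.BoundedBy {d H K : ℕ} (w : NetParams d H K) (R : ℝ) : Prop :=
  (∀ k j, |w.inW k j| ≤ R) ∧ (∀ k, |w.inB k| ≤ R) ∧
    (∀ i k j, |w.hidW i k j| ≤ R) ∧ (∀ i k, |w.hidB i k| ≤ R) ∧
    (∀ k, |w.outW k| ≤ R) ∧ |w.outB| ≤ R

/-- The parameter space of `FFNN^σ_{H,K}(R)`: weights and biases in `[-R, R]` for which the network
is a model from `X` to the prediction space `[0, 1]`. -/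
def ffnnParams {d : ℕ} (X : Set (Input d)) (σ : ℝ → ℝ) (H K : ℕ) (R : ℝ) :
    Set (NetParams d H K) :=
  {w | w.BoundedBy R ∧ ∀ x ∈ X, w.eval σ x ∈ Icc (0 : ℝ) 1}

/-- The assumptions on the activation function: continuous, not a polynomial, and continuously
differentiable at some point with nonzero derivative there. -/
structure IsAdmissibleActivation (σ : ℝ → ℝ) : Prop where
  continuous : Continuous σ
  not_polynomial : ¬ ∃ q : Polynomial ℝ, ∀ t, σ t = q.eval t
  exists_C1_point : ∃ a, (∀ᶠ t in 𝓝 a, DifferentiableAt ℝ σ t) ∧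
    ContinuousAt (deriv σ) a ∧ deriv σ a ≠ 0

end DataPruning

end

/-!
Let `Q` be the set of samples with score at most `c`, and `r = μ Q`. Almost surely the scores of the
samples are distinct, so that the pruned data set at level `r` and the samples in `Q` are sublevel
sets of the same score with asymptotically equally many elements. Sublevel sets are nested, hence
by the strong law of large numbers averages over the pruned data converge to averages over `Q`,
simultaneously for all continuous functions (`ae_forall_tendsto_pruned_average`). Pruning thus
replaces the risk `∫ ℓ` by `(∫_Q ℓ) / r`, and it remains to tell these functionals apart by networks.

*Networks.* Networks of width `d + 2` approximate every continuous function with values in `[0, 1]`,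
and the bound on their weights has to be the same for all large depths
(`exists_ffnnParams_approx`). Shallow networks are dense since the closure of their span contains
all powers of linear forms, extracted from Taylor expansions of mollifications of the activation
(`span_ridgeOn_dense`). A narrow deep network keeps the input in `d` registers, by means of neurons
working in the almost linear regime of the activation, and computes the terms of a shallow network
one after the other (`exists_isNetwork_approx`). The resulting weights depend on the depth. To reach
all depths with one bound, the output is passed through a chain of *latches*, small networks on the
line which map each cell of a fixed grid into itself with a margin. So the error stays below the grid
size however long the chain is, and a chain of any large length can be put together from finitely
many latches (`exists_isNetwork_isLatch`).

*Consistency.* By disintegration, `∫_Q ℓ (f x, y) dμ - r ∫ ℓ (f x, y) dμ` is the integral over the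
inputs of a weighted loss `u₀ ℓ (f x, 0) + u₁ ℓ (f x, 1)` with `(u₀, u₁) ≠ 0` everywhere. Such a
weighted loss is not constant in the prediction (`minLoss_add_minLoss_neg_lt`), so some continuous
`f` gives a nonzero integral (`exists_continuous_setIntegral_ne`), and so do networks close to `f`.

*Validity.* The minimal weighted loss is superadditive in the weights. If the score depends on the
labels, a threshold `c` between the two scores makes `Q` contain just one of the two labels at the
inputs of a set of positive measure on which both labels occur. There no prediction is optimal both
for the true label distribution and for the single label that is kept, because the optimal prediction
is a strictly increasing function of the label probability (`minLoss_add_lt`). After integration a gap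
remains (`DependsOnLabels.exists_threshold`): no prediction is nearly optimal for both functionals.
If training were valid, then, the parameters being bounded, a subsequence of the trained networks
would converge to a network that minimizes both functionals over the family
(`exists_common_minimizer`). As the family contains nearly optimal networks for each of them, this
contradicts the gap.
-/

noncomputable section

namespace DataPruning

/-! ### Ridge functions are dense -/

/-- A smooth function whose derivative of order `k + 1` vanishes is a polynomial of degree at most
`k`. -/
lemma exists_polynomial_of_iteratedDeriv_eq_zero {f : ℝ → ℝ} {k : ℕ}
    (hf : ContDiff ℝ (k + 1 : ℕ) f) (h0 : ∀ t, iteratedDeriv (k + 1) f t = 0) :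
    ∃ q : Polynomial ℝ, q.degree < (k + 1 : ℕ) ∧ ∀ t, f t = q.eval t := by
  refine ⟨∑ i ∈ Finset.range (k + 1),
    Polynomial.C (((i.factorial : ℝ)⁻¹) * iteratedDeriv i f 0) * Polynomial.X ^ i, ?_, ?_⟩
  · refine lt_of_le_of_lt (Polynomial.degree_sum_le _ _) ?_
    rw [Finset.sup_lt_iff (WithBot.bot_lt_coe _)]
    intro i hi
    exact lt_of_le_of_lt (Polynomial.degree_C_mul_X_pow_le _ _)
      (by exact_mod_cast Finset.mem_range.1 hi)
  · intro t
    rcases eq_or_ne t 0 with rfl | ht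
    · simp [Polynomial.eval_finsetSum, Finset.sum_range_succ']
    · obtain ⟨x', -, hx'⟩ := taylor_mean_remainder_lagrange_iteratedDeriv (n := k) (x₀ := 0)
        ht.symm (f := f) (by exact_mod_cast hf.contDiffOn)
      rw [h0, zero_mul, zero_div, sub_eq_zero, taylor_within_apply] at hx'
      have hud : UniqueDiffOn ℝ (uIcc 0 t) := uniqueDiffOn_Icc (by simpa using ht)
      rw [hx', Polynomial.eval_finsetSum]
      refine Finset.sum_congr rfl fun i hi => ?_
      rw [iteratedDerivWithin_eq_iteratedDeriv hud
        (hf.contDiffAt.of_le (by exact_mod_cast (Finset.mem_range.1 hi).le)) left_mem_uIcc]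
      simp
      ring

/-- A continuous function which is not a polynomial has mollifications with a nonzero derivative
of each given order: otherwise it is a pointwise limit of polynomials of bounded degree, and such
limits are polynomials by Lagrange interpolation. -/
lemma exists_mollification_iteratedDeriv_ne_zero {σ : ℝ → ℝ} (hc : Continuous σ)
    (hσ : ¬ ∃ q : Polynomial ℝ, ∀ t, σ t = q.eval t) (k : ℕ) :
    ∃ φ : ContDiffBump (0 : ℝ), ∃ b : ℝ, iteratedDeriv (k + 1)
      (convolution (φ.normed volume) σ (ContinuousLinearMap.lsmul ℝ ℝ) volume) b ≠ 0 := by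
  by_contra! hcon
  apply hσ
  let φ : ℕ → ContDiffBump (0 : ℝ) := fun n =>
    ⟨1 / ((n : ℝ) + 2), 1 / ((n : ℝ) + 1), by positivity,
      one_div_lt_one_div_of_lt (by positivity) (by linarith)⟩
  have hφ : Tendsto (fun n => (φ n).rOut) atTop (𝓝 0) := tendsto_one_div_add_atTop_nhds_zero_nat
  have hsm : ∀ n, ContDiff ℝ (k + 1 : ℕ) (convolution ((φ n).normed volume) σ
      (ContinuousLinearMap.lsmul ℝ ℝ) volume) := fun n =>
    (φ n).hasCompactSupport_normed.contDiff_convolution_left (n := (k + 1 : ℕ)) _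
      (φ n).contDiff_normed hc.locallyIntegrable
  choose q hq hq' using fun n => exists_polynomial_of_iteratedDeriv_eq_zero (hsm n) (hcon (φ n))
  have hlim : ∀ t, Tendsto (fun n => (q n).eval t) atTop (𝓝 (σ t)) := fun t => by
    have := ContDiffBump.convolution_tendsto_right_of_continuous (μ := volume) hφ hc t
    simpa only [hq'] using this
  have hinj : Set.InjOn (fun i : ℕ => (i : ℝ)) (Finset.range (k + 1)) :=
    Nat.cast_injective.injOn
  refine ⟨Lagrange.interpolate (Finset.range (k + 1)) (fun i : ℕ => (i : ℝ)) (fun i => σ i), ?_⟩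
  intro t
  refine tendsto_nhds_unique (hlim t) ?_
  have h1 : ∀ n, (q n).eval t = ∑ i ∈ Finset.range (k + 1), (q n).eval (i : ℝ) *
      (Lagrange.basis (Finset.range (k + 1)) (fun i : ℕ => (i : ℝ)) i).eval t := fun n => by
    conv_lhs => rw [Lagrange.eq_interpolate_of_eval_eq (fun i : ℕ => (q n).eval (i : ℝ)) hinj
      (by simpa using hq n) (fun i _ => rfl)]
    simp [Lagrange.interpolate_apply, Polynomial.eval_finsetSum]
  simp only [h1, Lagrange.interpolate_apply, Polynomial.eval_finsetSum, Polynomial.eval_mul,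
    Polynomial.eval_C]
  exact tendsto_finsetSum _ fun i _ => (hlim i).mul_const _

lemma integral_mem_of_isClosed {E : Type*} [NormedAddCommGroup E] [NormedSpace ℝ E]
    [CompleteSpace E] {V : Submodule ℝ E} (hV : IsClosed (V : Set E)) {F : ℝ → E}
    (hcF : Continuous F) (hsF : HasCompactSupport F) (hF : ∀ s, F s ∈ V) : ∫ s, F s ∈ V := by
  have : CompleteSpace V := hV.completeSpace_coe
  let F' : ℝ → V := fun s => ⟨F s, hF s⟩
  have hiF' : Integrable F' := (hcF.subtype_mk _).integrable_of_hasCompactSupport <|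
    hsF.mono' fun s hs => subset_tsupport _ (by simpa [F'] using hs)
  have hint : ∫ s, F s = V.subtypeL (∫ s, F' s) := V.subtypeL.integral_comp_comm hiF'
  rw [hint]
  exact Submodule.coe_mem _

section ClosedSubmodule

variable {S : Type*} [TopologicalSpace S] [CompactSpace S]

/-- The function `x ↦ σ (l u(x) + b)` as a continuous map. -/
def ridge {σ : ℝ → ℝ} (hc : Continuous σ) (u : C(S, ℝ)) (l b : ℝ) : C(S, ℝ) :=
  ⟨fun x => σ (l * u x + b), by fun_prop⟩

lemma ridge_mollification_mem {σ : ℝ → ℝ} (hc : Continuous σ) {V : Submodule ℝ C(S, ℝ)}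
    (hV : IsClosed (V : Set C(S, ℝ))) {u : C(S, ℝ)} (hu : ∀ l b, ridge hc u l b ∈ V)
    (φ : ContDiffBump (0 : ℝ)) (l b : ℝ) {v : C(S, ℝ)}
    (hv : ∀ x, v x = convolution (φ.normed volume) σ (ContinuousLinearMap.lsmul ℝ ℝ) volume
      (l * u x + b)) : v ∈ V := by
  let F : ℝ → C(S, ℝ) := fun s => φ.normed volume s • ridge hc u l (b - s)
  have hcF : Continuous F := by
    refine ContinuousMap.continuous_of_continuous_uncurry _ ?_
    have := φ.continuous_normed (μ := volume)
    simp only [F, ridge, Function.uncurry_def, ContinuousMap.smul_apply, ContinuousMap.coe_mk,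
      smul_eq_mul]
    fun_prop
  have hsF : HasCompactSupport F := φ.hasCompactSupport_normed.smul_right
  have hiF : Integrable F := hcF.integrable_of_hasCompactSupport hsF
  have hvF : v = ∫ s, F s := by
    ext x
    rw [ContinuousMap.integral_apply hiF, hv, convolution_def]
    refine integral_congr_ae (Eventually.of_forall fun s => ?_)
    simp [F, ridge, add_sub_assoc]
  rw [hvF]
  exact integral_mem_of_isClosed hV hcF hsF fun s => V.smul_mem _ (hu _ _)

/-- If a closed subspace contains all `σ (l u + b)` and `σ` is not a polynomial, it contains all
powers of `u`. They are extracted one after the other from the Taylor expansion of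
`h ↦ ψ (h u + b)` at `0`, for a mollification `ψ` of `σ` with `ψ⁽ᵏ⁾ (b) ≠ 0`. -/
lemma pow_mem_of_ridge_mem {σ : ℝ → ℝ} (hc : Continuous σ)
    (hσ : ¬ ∃ q : Polynomial ℝ, ∀ t, σ t = q.eval t) {V : Submodule ℝ C(S, ℝ)}
    (hV : IsClosed (V : Set C(S, ℝ))) {u : C(S, ℝ)} (hu : ∀ l b, ridge hc u l b ∈ V) (k : ℕ) :
    u ^ k ∈ V := by
  induction k using Nat.strong_induction_on with
  | _ k ih =>
  rcases k with _ | k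
  · have : ∃ b, σ b ≠ 0 := by
      by_contra! h
      exact hσ ⟨0, by simpa using h⟩
    obtain ⟨b, hb⟩ := this
    have h1 := V.smul_mem (σ b)⁻¹ (hu 0 b)
    convert h1 using 1
    ext x
    simp [ridge, hb]
  obtain ⟨φ, b, hφb⟩ := exists_mollification_iteratedDeriv_ne_zero hc hσ k
  set ψ := convolution (φ.normed volume) σ (ContinuousLinearMap.lsmul ℝ ℝ) volume with hψ
  have hsm : ContDiff ℝ (k + 1 : ℕ) ψ :=
    φ.hasCompactSupport_normed.contDiff_convolution_left (n := (k + 1 : ℕ)) _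
      φ.contDiff_normed hc.locallyIntegrable
  have hψc : Continuous ψ := hsm.continuous
  -- `w h` is the Taylor remainder of order `k`, divided by `h ^ (k + 1)`
  let w : ℝ → C(S, ℝ) := fun h => (h ^ (k + 1))⁻¹ • (⟨fun x => ψ (h * u x + b), by fun_prop⟩ -
    ∑ i ∈ Finset.range (k + 1), (((i.factorial : ℝ)⁻¹ * h ^ i) * iteratedDeriv i ψ b) • u ^ i)
  have hw : ∀ h, w h ∈ V := fun h => V.smul_mem _ (V.sub_mem
    (ridge_mollification_mem hc hV hu φ h b fun x => rfl)
    (V.sum_mem fun i hi => V.smul_mem _ (ih i (Finset.mem_range.1 hi))))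
  set c : ℝ := ((k + 1).factorial : ℝ)⁻¹ * iteratedDeriv (k + 1) ψ b with hcdef
  have hc0 : c ≠ 0 := mul_ne_zero (by positivity) hφb
  have hlim : Tendsto w (𝓝[≠] 0) (𝓝 (c • u ^ (k + 1))) := by
    have hT := taylor_isLittleO_univ (x₀ := b) hsm
    rw [Metric.tendsto_nhds]
    intro ε hε
    set M : ℝ := ‖u‖ + 1 with hM
    have hMpos : 0 < M := by positivity
    rw [Asymptotics.isLittleO_iff] at hT
    have hT' := @hT (ε / 2 / M ^ (k + 1)) (by positivity)
    rw [Metric.eventually_nhds_iff] at hT'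
    obtain ⟨δ, hδ, hT'⟩ := hT'
    have hev : ∀ᶠ h : ℝ in 𝓝[≠] 0, |h| < δ / M := by
      refine nhdsWithin_le_nhds ?_
      have := Metric.ball_mem_nhds (0 : ℝ) (div_pos hδ hMpos)
      filter_upwards [this] with h hh
      simpa using hh
    filter_upwards [hev, self_mem_nhdsWithin] with h hh hh0
    have hh0 : h ≠ 0 := hh0
    refine lt_of_le_of_lt ?_ (half_lt_self hε)
    rw [ContinuousMap.dist_le (by positivity)]
    intro x
    have hux : |u x| ≤ M := (u.norm_coe_le_norm x).trans (by rw [hM]; linarith)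
    have hd : dist (h * u x + b) b < δ := by
      rw [Real.dist_eq, add_sub_cancel_right, abs_mul]
      calc |h| * |u x| ≤ |h| * M := by gcongr
        _ < δ / M * M := by gcongr
        _ = δ := by field_simp
    have h3 := hT' hd
    rw [add_sub_cancel_right, taylor_within_apply, Finset.sum_range_succ] at h3
    simp only [iteratedDerivWithin_univ, add_sub_cancel_right, smul_eq_mul, norm_pow, norm_mul,
      Real.norm_eq_abs] at h3
    have hpow : 0 < |h| ^ (k + 1) := by positivity
    rw [Real.dist_eq]
    have heq : w h x - (c • u ^ (k + 1)) x = (h ^ (k + 1))⁻¹ *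
        (ψ (h * u x + b) - (∑ i ∈ Finset.range (k + 1), (i.factorial : ℝ)⁻¹ * (h * u x) ^ i *
          iteratedDeriv i ψ b + ((k + 1).factorial : ℝ)⁻¹ * (h * u x) ^ (k + 1) *
          iteratedDeriv (k + 1) ψ b)) := by
      simp only [w, ContinuousMap.smul_apply, ContinuousMap.sub_apply, ContinuousMap.coe_mk,
        ContinuousMap.coe_sum, Finset.sum_apply, smul_eq_mul, ContinuousMap.pow_apply, hcdef]
      have : ∑ i ∈ Finset.range (k + 1), (i.factorial : ℝ)⁻¹ * (h * u x) ^ i *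
          iteratedDeriv i ψ b = ∑ i ∈ Finset.range (k + 1),
            (i.factorial : ℝ)⁻¹ * h ^ i * iteratedDeriv i ψ b * u x ^ i :=
        Finset.sum_congr rfl fun i _ => by ring
      rw [this]
      field_simp
      ring
    rw [heq, abs_mul, abs_inv, abs_pow, inv_mul_le_iff₀ hpow]
    refine h3.trans ?_
    rw [mul_pow]
    have : |u x| ^ (k + 1) ≤ M ^ (k + 1) := by gcongr
    calc ε / 2 / M ^ (k + 1) * (|h| ^ (k + 1) * |u x| ^ (k + 1))
        ≤ ε / 2 / M ^ (k + 1) * (|h| ^ (k + 1) * M ^ (k + 1)) := by gcongr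
      _ = |h| ^ (k + 1) * (ε / 2) := by field_simp
  have hmem : c • u ^ (k + 1) ∈ V :=
    hV.mem_of_tendsto hlim (Eventually.of_forall hw)
  exact (V.smul_mem_iff hc0).1 hmem

lemma exp_mem_of_ridge_mem {σ : ℝ → ℝ} (hc : Continuous σ)
    (hσ : ¬ ∃ q : Polynomial ℝ, ∀ t, σ t = q.eval t) {V : Submodule ℝ C(S, ℝ)}
    (hV : IsClosed (V : Set C(S, ℝ))) {u : C(S, ℝ)} (hu : ∀ l b, ridge hc u l b ∈ V) :
    (⟨fun x => Real.exp (u x), by fun_prop⟩ : C(S, ℝ)) ∈ V := by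
  have h1 : HasSum (fun n : ℕ => ((n.factorial : ℝ)⁻¹) • u ^ n) (NormedSpace.exp u) :=
    NormedSpace.exp_series_hasSum_exp' (𝕂 := ℝ) u
  have h2 : NormedSpace.exp u = (⟨fun x => Real.exp (u x), by fun_prop⟩ : C(S, ℝ)) := by
    ext x
    have h3 := h1.map (ContinuousMap.evalCLM ℝ x) (ContinuousMap.evalCLM ℝ x).continuous
    have h4 := NormedSpace.exp_series_hasSum_exp' (𝕂 := ℝ) (u x)
    rw [← Real.exp_eq_exp_ℝ] at h4
    exact h3.unique (by simpa [Function.comp_def] using h4)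
  rw [← h2]
  exact hV.mem_of_tendsto h1 (Eventually.of_forall fun s =>
    V.sum_mem fun i _ => V.smul_mem _ (pow_mem_of_ridge_mem hc hσ hV hu i))

end ClosedSubmodule

/-- The linear form `x ↦ ⟨a, x⟩` on a subset of `ℝ^m`. -/
def linearOn {m : ℕ} (S : Set (Fin m → ℝ)) (a : Fin m → ℝ) : C(S, ℝ) :=
  ⟨fun x => ∑ i, a i * x.1 i, continuous_finsetSum _ fun i _ =>
    continuous_const.mul ((continuous_apply i).comp continuous_subtype_val)⟩

/-- The function `x ↦ σ (⟨a, x⟩ + b)` on a subset of `ℝ^m`. -/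
def ridgeOn {σ : ℝ → ℝ} (hc : Continuous σ) {m : ℕ} (S : Set (Fin m → ℝ)) (a : Fin m → ℝ) (b : ℝ) :
    C(S, ℝ) :=
  ⟨fun x => σ (linearOn S a x + b), by fun_prop⟩

/-- Shallow networks with a continuous non-polynomial activation are dense in the continuous
functions on a compact set. By `exp_mem_of_ridge_mem` their closure contains the span of the
exponentials of linear forms, a subalgebra which separates points. -/
theorem span_ridgeOn_dense {σ : ℝ → ℝ} (hc : Continuous σ)
    (hσ : ¬ ∃ q : Polynomial ℝ, ∀ t, σ t = q.eval t) {m : ℕ} {S : Set (Fin m → ℝ)}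
    (hS : IsCompact S) :
    (Submodule.span ℝ (range fun q : (Fin m → ℝ) × ℝ => ridgeOn hc S q.1 q.2)).topologicalClosure
      = ⊤ := by
  have : CompactSpace S := isCompact_iff_compactSpace.1 hS
  set V := (Submodule.span ℝ
    (range fun q : (Fin m → ℝ) × ℝ => ridgeOn hc S q.1 q.2)).topologicalClosure with hVdef
  have hV : IsClosed (V : Set C(S, ℝ)) := Submodule.isClosed_topologicalClosure _
  let E : (Fin m → ℝ) → C(S, ℝ) := fun a => ⟨fun x => Real.exp (linearOn S a x), by fun_prop⟩
  have hE : ∀ a, E a ∈ V := fun a => by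
    refine exp_mem_of_ridge_mem hc hσ hV (u := linearOn S a) ?_
    intro l b
    refine Submodule.le_topologicalClosure _ (Submodule.subset_span ⟨(l • a, b), ?_⟩)
    ext x
    simp [ridgeOn, ridge, linearOn, Finset.mul_sum, mul_assoc]
  let G : Submonoid C(S, ℝ) :=
    { carrier := range E
      one_mem' := ⟨0, by ext x; simp [E, linearOn]⟩
      mul_mem' := by
        rintro _ _ ⟨a, rfl⟩ ⟨b, rfl⟩
        refine ⟨a + b, ?_⟩
        ext x
        simp [E, linearOn, add_mul, Finset.sum_add_distrib, Real.exp_add] }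
  let B : Subalgebra ℝ C(S, ℝ) := Algebra.adjoin ℝ (G : Set C(S, ℝ))
  have hB : Subalgebra.toSubmodule B = Submodule.span ℝ (G : Set C(S, ℝ)) := by
    rw [Algebra.adjoin_eq_span, Submonoid.closure_eq]
  have hsep : B.SeparatesPoints := by
    intro x y hxy
    have : ∃ i, x.1 i ≠ y.1 i := by
      by_contra! h
      exact hxy (Subtype.ext (funext h))
    obtain ⟨i, hi⟩ := this
    refine ⟨E (Pi.single i 1), ⟨E (Pi.single i 1), Algebra.subset_adjoin ⟨_, rfl⟩, rfl⟩, ?_⟩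
    simpa [E, linearOn, Pi.single_apply] using hi
  have htop := ContinuousMap.subalgebra_topologicalClosure_eq_top_of_separatesPoints B hsep
  have hBV : (B : Set C(S, ℝ)) ⊆ V := by
    intro f hf
    have : f ∈ Subalgebra.toSubmodule B := hf
    rw [hB] at this
    refine (Submodule.span_le.2 ?_) this
    rintro _ ⟨a, rfl⟩
    exact hE a
  rw [eq_top_iff]
  intro f _
  have hf : f ∈ B.topologicalClosure := by rw [htop]; trivial
  exact closure_minimal hBV hV hf

/-! ### Deep networks of width `m + 2` are dense -/

/-- `PreActivation σ R Rh n F`: the map `F : ℝ^m → ℝ^K` is the input of the activations of the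
hidden layer number `n + 1` of some network of width `K`, whose weights and biases are bounded by
`R` in the first layer and by `Rh` in the other ones. -/
inductive PreActivation (σ : ℝ → ℝ) {m K : ℕ} (R Rh : ℝ) :
    ℕ → ((Fin m → ℝ) → Fin K → ℝ) → Prop
  | base (W : Matrix (Fin K) (Fin m) ℝ) (b : Fin K → ℝ) (hW : ∀ k j, |W k j| ≤ R)
      (hb : ∀ k, |b k| ≤ R) : PreActivation σ R Rh 0 (fun x k => W.mulVec x k + b k)
  | step {n : ℕ} {F : (Fin m → ℝ) → Fin K → ℝ} (hF : PreActivation σ R Rh n F)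
      (W : Matrix (Fin K) (Fin K) ℝ) (b : Fin K → ℝ) (hW : ∀ k j, |W k j| ≤ Rh)
      (hb : ∀ k, |b k| ≤ Rh) :
      PreActivation σ R Rh (n + 1) (fun x k => W.mulVec (fun j => σ (F x j)) k + b k)

lemma PreActivation.mono {σ : ℝ → ℝ} {m K : ℕ} {R Rh R' Rh' : ℝ} {n : ℕ}
    {F : (Fin m → ℝ) → Fin K → ℝ} (hF : PreActivation σ R Rh n F) (h : R ≤ R') (hh : Rh ≤ Rh') :
    PreActivation σ R' Rh' n F := by
  induction hF with
  | base W b hW hb => exact .base W b (fun k j => (hW k j).trans h) (fun k => (hb k).trans h)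
  | step _ W b hW hb ih =>
    exact .step ih W b (fun k j => (hW k j).trans hh) (fun k => (hb k).trans hh)

lemma exists_entries_le {ι κ : Type*} [Finite ι] [Finite κ] (W : Matrix ι κ ℝ) (b : ι → ℝ) :
    ∃ R, (∀ k j, |W k j| ≤ R) ∧ ∀ k, |b k| ≤ R := by
  obtain ⟨R₁, h₁⟩ := (finite_range fun q : ι × κ => |W q.1 q.2|).bddAbove
  obtain ⟨R₂, h₂⟩ := (finite_range fun k => |b k|).bddAbove
  exact ⟨max R₁ R₂, fun k j => (h₁ ⟨(k, j), rfl⟩).trans (le_max_left _ _),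
    fun k => (h₂ ⟨k, rfl⟩).trans (le_max_right _ _)⟩

/-- Affine maps can be absorbed in the last affine map of a pre-activation. -/
lemma PreActivation.exists_affine {σ : ℝ → ℝ} {m K : ℕ} {R : ℝ} {n : ℕ}
    {F : (Fin m → ℝ) → Fin K → ℝ} (hF : PreActivation σ R R n F)
    (W' : Matrix (Fin K) (Fin K) ℝ) (b' : Fin K → ℝ) :
    ∃ R', PreActivation σ R' R' n (fun x k => W'.mulVec (F x) k + b' k) := by
  cases hF with
  | base W b hW hb =>
    obtain ⟨R', h₁, h₂⟩ := exists_entries_le (W' * W) (W'.mulVec b + b')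
    refine ⟨R', ?_⟩
    convert PreActivation.base (Rh := R') (σ := σ) (W' * W) (W'.mulVec b + b') h₁ h₂ using 3
      with x k
    rw [← Matrix.mulVec_mulVec, Pi.add_apply, ← add_assoc]
    exact congrArg (· + b' k) (congrFun (Matrix.mulVec_add W' (W.mulVec x) b) k)
  | step hF W b hW hb =>
    rename_i n F
    obtain ⟨R', h₁, h₂⟩ := exists_entries_le (W' * W) (W'.mulVec b + b')
    refine ⟨max R R', ?_⟩
    convert PreActivation.step (hF.mono (le_max_left R R') (le_max_left R R')) (W' * W)
      (W'.mulVec b + b') (fun k j => (h₁ k j).trans (le_max_right _ _))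
      (fun k => (h₂ k).trans (le_max_right _ _)) using 3 with x k
    rw [← Matrix.mulVec_mulVec, Pi.add_apply, ← add_assoc]
    exact congrArg (· + b' k) (congrFun (Matrix.mulVec_add W' _ b) k)

section Closure

variable {σ : ℝ → ℝ} {m K : ℕ} {S : Set (Fin m → ℝ)}

/-- `F` is a uniform limit on `S` of pre-activations of the layer number `n + 1`. -/
def IsPreActivationLimit (σ : ℝ → ℝ) (n : ℕ) (F : Fin K → C(S, ℝ)) : Prop :=
  ∀ ε > 0, ∃ R, ∃ G : (Fin m → ℝ) → Fin K → ℝ, PreActivation σ R R n G ∧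
    ∀ (x : S) (k : Fin K), |G x.1 k - F k x| ≤ ε

lemma IsPreActivationLimit.of_approx {n : ℕ} {F : Fin K → C(S, ℝ)}
    (h : ∀ ε > 0, ∃ F' : Fin K → C(S, ℝ), IsPreActivationLimit σ n F' ∧
      ∀ x k, |F' k x - F k x| ≤ ε) : IsPreActivationLimit σ n F := by
  intro ε hε
  obtain ⟨F', hF', hd⟩ := h (ε / 2) (half_pos hε)
  obtain ⟨R, G, hG, hGd⟩ := hF' (ε / 2) (half_pos hε)
  refine ⟨R, G, hG, fun x k => ?_⟩
  calc |G x.1 k - F k x| ≤ |G x.1 k - F' k x| + |F' k x - F k x| := abs_sub_le _ _ _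
    _ ≤ ε / 2 + ε / 2 := add_le_add (hGd x k) (hd x k)
    _ = ε := add_halves ε

lemma IsPreActivationLimit.affine {n : ℕ} {F F' : Fin K → C(S, ℝ)}
    (hF : IsPreActivationLimit σ n F) (W : Matrix (Fin K) (Fin K) ℝ) (b : Fin K → ℝ)
    (h : ∀ x k, F' k x = W.mulVec (fun j => F j x) k + b k) : IsPreActivationLimit σ n F' := by
  intro ε hε
  set C : ℝ := 1 + ∑ k, ∑ j, |W k j| with hC
  have hC0 : 0 < C := by positivity
  obtain ⟨R, G, hG, hGd⟩ := hF (ε / C) (by positivity)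
  obtain ⟨R', hR'⟩ := hG.exists_affine W b
  refine ⟨R', _, hR', fun x k => ?_⟩
  rw [h, add_sub_add_right_eq_sub]
  have h1 : W.mulVec (G x.1) k - W.mulVec (fun j => F j x) k =
      ∑ j, W k j * (G x.1 j - F j x) := by
    simp [Matrix.mulVec, dotProduct, mul_sub]
  rw [h1]
  calc |∑ j, W k j * (G x.1 j - F j x)| ≤ ∑ j, |W k j| * (ε / C) := by
        refine (Finset.abs_sum_le_sum_abs _ _).trans (Finset.sum_le_sum fun j _ => ?_)
        rw [abs_mul]
        exact mul_le_mul_of_nonneg_left (hGd x j) (abs_nonneg _)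
    _ = (∑ j, |W k j|) * (ε / C) := by rw [Finset.sum_mul]
    _ ≤ C * (ε / C) := by
        gcongr
        have := Finset.single_le_sum (f := fun k => ∑ j, |W k j|)
          (fun i _ => Finset.sum_nonneg fun j _ => abs_nonneg _) (Finset.mem_univ k)
        exact this.trans (by linarith)
    _ = ε := by field_simp

lemma IsPreActivationLimit.of_mem_span {n : ℕ} {F F' : Fin K → C(S, ℝ)}
    (hF : IsPreActivationLimit σ n F)
    (h : ∀ k, F' k ∈ Submodule.span ℝ (insert 1 (range F))) : IsPreActivationLimit σ n F' := by
  have h' : ∀ k, ∃ c₀ : ℝ, ∃ c : Fin K → ℝ, F' k = c₀ • (1 : C(S, ℝ)) + ∑ j, c j • F j :=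
    fun k => by
      obtain ⟨c₀, z, hz, hk⟩ := Submodule.mem_span_insert.1 (h k)
      obtain ⟨c, rfl⟩ := (Submodule.mem_span_range_iff_exists_fun ℝ).1 hz
      exact ⟨c₀, c, hk⟩
  choose b W hW using h'
  refine hF.affine W b fun x k => ?_
  rw [hW k]
  simp [Matrix.mulVec, dotProduct, ContinuousMap.coe_sum, add_comm]

lemma IsPreActivationLimit.comp_activation [CompactSpace S] (hc : Continuous σ) {n : ℕ}
    {F : Fin K → C(S, ℝ)}
    (hF : IsPreActivationLimit σ n F) :
    IsPreActivationLimit σ (n + 1) (fun k => (⟨σ, hc⟩ : C(ℝ, ℝ)).comp (F k)) := by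
  intro ε hε
  set B : ℝ := ∑ k, ‖F k‖ with hB
  have hFB : ∀ k x, |F k x| ≤ B := fun k x =>
    ((F k).norm_coe_le_norm x).trans
      (Finset.single_le_sum (f := fun k => ‖F k‖) (fun i _ => norm_nonneg _) (Finset.mem_univ k))
  have huc := (isCompact_Icc (a := -(B + 1)) (b := B + 1)).uniformContinuousOn_of_continuous
    hc.continuousOn
  obtain ⟨δ, hδ, hσδ⟩ := Metric.uniformContinuousOn_iff.1 huc ε hε
  obtain ⟨R, G, hG, hGd⟩ := hF (min (δ / 2) 1) (by positivity)
  obtain ⟨R', h₁, h₂⟩ := exists_entries_le (1 : Matrix (Fin K) (Fin K) ℝ) (0 : Fin K → ℝ)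
  refine ⟨max R R', _, PreActivation.step (hG.mono (le_max_left R R') (le_max_left R R')) 1 0
    (fun k j => (h₁ k j).trans (le_max_right _ _)) (fun k => (h₂ k).trans (le_max_right _ _)), ?_⟩
  intro x k
  have h3 := hGd x k
  have h4 := abs_le.1 (hFB k x)
  have h5 := abs_le.1 (h3.trans (min_le_right _ _))
  simp only [Matrix.one_mulVec, Pi.zero_apply, add_zero, ContinuousMap.comp_apply,
    ContinuousMap.coe_mk]
  refine (hσδ _ ⟨by linarith, by linarith⟩ _ ⟨by linarith, by linarith⟩ ?_).le
  exact lt_of_le_of_lt (h3.trans (min_le_left _ _)) (half_lt_self hδ)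

open scoped Classical in
/-- A further layer may apply the activation to some coordinates and leave the other ones
unchanged: near a point `a` with `σ' a ≠ 0` the map `t ↦ (σ (a + h t) - σ a) / (h σ' a)` is close
to the identity for small `h`. -/
lemma IsPreActivationLimit.comp_activation_or_id [CompactSpace S] (hc : Continuous σ) {a : ℝ}
    (ha : DifferentiableAt ℝ σ a) (ha0 : deriv σ a ≠ 0) {n : ℕ} {F : Fin K → C(S, ℝ)}
    (hF : IsPreActivationLimit σ n F) (P : Fin K → Prop) :
    IsPreActivationLimit σ (n + 1)
      (fun k => if P k then (⟨σ, hc⟩ : C(ℝ, ℝ)).comp (F k) else F k) := by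
  refine IsPreActivationLimit.of_approx fun ε hε => ?_
  set B : ℝ := 1 + ∑ k, ‖F k‖ with hB
  have hB0 : 0 < B := by positivity
  have hFB : ∀ k x, |F k x| ≤ B := fun k x => by
    have h1 := (F k).norm_coe_le_norm x
    have h2 := Finset.single_le_sum (f := fun k => ‖F k‖) (fun i _ => norm_nonneg _)
      (Finset.mem_univ k)
    simp only [Real.norm_eq_abs] at h1 h2
    linarith
  have hd := ha.hasDerivAt.isLittleO
  have hd' := (Asymptotics.isLittleO_iff.1 hd) (c := |deriv σ a| * ε / B) (by positivity)
  obtain ⟨δ, hδ, hd'⟩ := Metric.eventually_nhds_iff.1 hd'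
  set h : ℝ := δ / (2 * B) with hh
  have hh0 : 0 < h := by positivity
  let F₁ : Fin K → C(S, ℝ) := fun k => if P k then F k else ContinuousMap.const S a + h • F k
  have hF₁ : IsPreActivationLimit σ n F₁ := by
    refine hF.of_mem_span fun k => ?_
    have hk : F k ∈ Submodule.span ℝ (insert 1 (range F)) :=
      Submodule.subset_span (Or.inr ⟨k, rfl⟩)
    by_cases hP : P k
    · simpa [F₁, hP] using hk
    · simp only [F₁, hP, if_false]
      refine Submodule.add_mem _ ?_ (Submodule.smul_mem _ _ hk)
      have : ContinuousMap.const S a = a • (1 : C(S, ℝ)) := by ext; simp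
      rw [this]
      exact Submodule.smul_mem _ _ (Submodule.subset_span (Or.inl rfl))
  let F₂ : Fin K → C(S, ℝ) := fun k => if P k then (⟨σ, hc⟩ : C(ℝ, ℝ)).comp (F₁ k) else
    (h * deriv σ a)⁻¹ • ((⟨σ, hc⟩ : C(ℝ, ℝ)).comp (F₁ k) - σ a • 1)
  have hF₂ : IsPreActivationLimit σ (n + 1) F₂ := by
    refine (hF₁.comp_activation hc).of_mem_span fun k => ?_
    have hk : (⟨σ, hc⟩ : C(ℝ, ℝ)).comp (F₁ k) ∈ Submodule.span ℝ
        (insert 1 (range fun k => (⟨σ, hc⟩ : C(ℝ, ℝ)).comp (F₁ k))) :=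
      Submodule.subset_span (Or.inr ⟨k, rfl⟩)
    by_cases hP : P k
    · simpa [F₂, hP] using hk
    · simp only [F₂, hP, if_false]
      exact Submodule.smul_mem _ _ (Submodule.sub_mem _ hk
        (Submodule.smul_mem _ _ (Submodule.subset_span (Or.inl rfl))))
  refine ⟨F₂, hF₂, fun x k => ?_⟩
  by_cases hP : P k
  · simp [F₂, F₁, hP, hε.le]
  · have h1 : dist (a + h * F k x) a < δ := by
      rw [Real.dist_eq, add_sub_cancel_left, abs_mul, abs_of_pos hh0]
      calc h * |F k x| ≤ h * B := by gcongr; exact hFB k x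
        _ = δ / 2 := by rw [hh]; field_simp
        _ < δ := half_lt_self hδ
    have h2 := hd' h1
    simp only [add_sub_cancel_left, Real.norm_eq_abs, smul_eq_mul] at h2
    have h3 : F₂ k x - (if P k then (⟨σ, hc⟩ : C(ℝ, ℝ)).comp (F k) else F k) x =
        (h * deriv σ a)⁻¹ * (σ (a + h * F k x) - σ a - h * F k x * deriv σ a) := by
      simp only [F₂, F₁, hP, if_false, ContinuousMap.smul_apply, ContinuousMap.sub_apply,
        ContinuousMap.comp_apply, ContinuousMap.coe_mk, ContinuousMap.add_apply,
        ContinuousMap.const_apply, ContinuousMap.one_apply, smul_eq_mul]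
      field_simp
    rw [h3, abs_mul, abs_inv, abs_mul, abs_of_pos hh0]
    rw [abs_mul, abs_of_pos hh0] at h2
    rw [inv_mul_le_iff₀ (by positivity)]
    refine h2.trans ?_
    calc |deriv σ a| * ε / B * (h * |F k x|) ≤ |deriv σ a| * ε / B * (h * B) := by
          gcongr; exact hFB k x
      _ = h * |deriv σ a| * ε := by field_simp

/-- The register state of a narrow network: the first `m` neurons store the input `x`, the next one
holds `p x`, and all other ones hold `s x`. -/
def registers (K : ℕ) (s p : C(S, ℝ)) (k : Fin K) : C(S, ℝ) :=
  if h : k.1 < m then linearOn S (Pi.single ⟨k.1, h⟩ 1) else if k.1 = m then p else s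

lemma linearOn_mem_span_registers (hK : m + 2 ≤ K) (s p : C(S, ℝ)) (a : Fin m → ℝ) :
    linearOn S a ∈ Submodule.span ℝ (insert 1 (range (registers K s p))) := by
  have : linearOn S a = ∑ i, a i • registers K s p ⟨i.1, by omega⟩ := by
    ext x
    simp [linearOn, registers, ContinuousMap.coe_sum, Pi.single_apply]
  rw [this]
  exact Submodule.sum_mem _ fun i _ => Submodule.smul_mem _ _
    (Submodule.subset_span (Or.inr ⟨_, rfl⟩))

/-- One more layer adds a multiple of a ridge function to the content of the last register. -/
lemma IsPreActivationLimit.registers_add [CompactSpace S] (hK : m + 2 ≤ K) (hc : Continuous σ)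
    {a : ℝ}
    (ha : DifferentiableAt ℝ σ a) (ha0 : deriv σ a ≠ 0) {n : ℕ} {s : C(S, ℝ)}
    (hs : IsPreActivationLimit σ n (registers K s 0)) (c : ℝ) (v : Fin m → ℝ) (b : ℝ) :
    IsPreActivationLimit σ (n + 1) (registers K (s + c • ridgeOn hc S v b) 0) := by
  classical
  have hreg : ∀ (s p q : C(S, ℝ)), q ∈ Submodule.span ℝ (insert 1 (range (registers K s p))) →
      ∀ t ∈ Submodule.span ℝ (insert 1 (range (registers K s p))), ∀ k,
        registers K t q k ∈ Submodule.span ℝ (insert 1 (range (registers K s p))) := by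
    intro s p q hq t ht k
    by_cases h1 : k.1 < m
    · simpa only [registers, h1, dif_pos] using linearOn_mem_span_registers hK s p _
    · by_cases h2 : k.1 = m <;> simpa [registers, h1, h2]
  have hlast : ∀ s p : C(S, ℝ), s ∈ Submodule.span ℝ (insert 1 (range (registers K s p))) :=
    fun s p => Submodule.subset_span (Or.inr ⟨⟨m + 1, by omega⟩, by simp [registers]⟩)
  have hmid : ∀ s p : C(S, ℝ), p ∈ Submodule.span ℝ (insert 1 (range (registers K s p))) :=
    fun s p => Submodule.subset_span (Or.inr ⟨⟨m, by omega⟩, by simp [registers]⟩)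
  have h1 : IsPreActivationLimit σ n (registers K s (linearOn S v + b • 1)) := by
    refine hs.of_mem_span (hreg s 0 _ (Submodule.add_mem _ (linearOn_mem_span_registers hK s 0 v)
      (Submodule.smul_mem _ _ (Submodule.subset_span (Or.inl rfl)))) _ (hlast s 0))
  have h2 : IsPreActivationLimit σ (n + 1) (registers K s (ridgeOn hc S v b)) := by
    convert h1.comp_activation_or_id hc ha ha0 (fun k => k.1 = m) using 1
    ext k x
    by_cases h1 : k.1 < m
    · simp [registers, h1, h1.ne]
    · by_cases h2 : k.1 = m <;> simp [registers, h2, h1, ridgeOn]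
  exact h2.of_mem_span (hreg _ _ 0 (Submodule.zero_mem _) _ (Submodule.add_mem _ (hlast _ _)
    (Submodule.smul_mem _ _ (hmid _ _))))

lemma isPreActivationLimit_registers_zero :
    IsPreActivationLimit σ 0 (registers (S := S) K 0 0) := by
  intro ε hε
  let W : Matrix (Fin K) (Fin m) ℝ := fun k j => if k.1 = j.1 then 1 else 0
  obtain ⟨R, h₁, h₂⟩ := exists_entries_le W 0
  refine ⟨R, _, .base W 0 h₁ h₂, fun x k => ?_⟩
  have : W.mulVec x.1 k + (0 : Fin K → ℝ) k = registers (S := S) K 0 0 k x := by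
    by_cases h1 : k.1 < m
    · have : ∀ i : Fin m, (k.1 = i.1) = (i = ⟨k.1, h1⟩) := fun i => by
        rw [Fin.ext_iff, @eq_comm _ k.1]
      simp [W, registers, h1, linearOn, Matrix.mulVec, dotProduct, Pi.single_apply, this]
    · have : ∀ i : Fin m, k.1 ≠ i.1 := fun i => by have := i.2; omega
      simp [W, registers, h1, Matrix.mulVec, dotProduct, this]
  rw [this]
  simpa using hε.le

lemma exists_isPreActivationLimit_registers [CompactSpace S] (hK : m + 2 ≤ K) (hc : Continuous σ)
    {a : ℝ}
    (ha : DifferentiableAt ℝ σ a) (ha0 : deriv σ a ≠ 0) {h : C(S, ℝ)}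
    (hh : h ∈ Submodule.span ℝ (range fun q : (Fin m → ℝ) × ℝ => ridgeOn hc S q.1 q.2)) :
    ∃ n₀, ∀ n ≥ n₀, IsPreActivationLimit σ n (registers K h 0) := by
  have key : ∀ (c : ℝ) (s : C(S, ℝ)) (n : ℕ), IsPreActivationLimit σ n (registers K s 0) →
      ∃ n', IsPreActivationLimit σ n' (registers K (s + c • h) 0) := by
    induction hh using Submodule.span_induction with
    | mem h hh =>
      obtain ⟨q, rfl⟩ := hh
      exact fun c s n hs => ⟨n + 1, hs.registers_add hK hc ha ha0 c q.1 q.2⟩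
    | zero => exact fun c s n hs => ⟨n, by simpa using hs⟩
    | add h₁ h₂ _ _ ih₁ ih₂ =>
      intro c s n hs
      obtain ⟨n₁, hn₁⟩ := ih₁ c s n hs
      obtain ⟨n₂, hn₂⟩ := ih₂ c _ n₁ hn₁
      exact ⟨n₂, by rwa [smul_add, ← add_assoc]⟩
    | smul r h _ ih =>
      intro c s n hs
      obtain ⟨n₁, hn₁⟩ := ih (c * r) s n hs
      exact ⟨n₁, by rwa [smul_smul]⟩
  obtain ⟨n₀, hn₀⟩ := key 1 0 0 isPreActivationLimit_registers_zero
  rw [zero_add, one_smul] at hn₀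
  refine ⟨n₀, fun n hn => ?_⟩
  induction n, hn using Nat.le_induction with
  | base => exact hn₀
  | succ n _ ih => simpa using ih.registers_add hK hc ha ha0 0 0 0

end Closure

/-- `f` is the output of a network with input in `ℝ^m` and `n + 1` hidden layers of `K` neurons,
whose weights and biases are bounded by `R` in the first and in the output layer, and by `Rh` in
between. -/
def IsNetwork (σ : ℝ → ℝ) (K : ℕ) {m : ℕ} (R Rh : ℝ) (n : ℕ) (f : (Fin m → ℝ) → ℝ) : Prop :=
  ∃ F : (Fin m → ℝ) → Fin K → ℝ, PreActivation σ R Rh n F ∧ ∃ (c : Fin K → ℝ) (c₀ : ℝ),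
    (∀ k, |c k| ≤ R) ∧ |c₀| ≤ R ∧ ∀ x, f x = ∑ k, c k * σ (F x k) + c₀

lemma IsNetwork.mono {σ : ℝ → ℝ} {K m : ℕ} {R Rh R' Rh' : ℝ} {n : ℕ} {f : (Fin m → ℝ) → ℝ}
    (hf : IsNetwork σ K R Rh n f) (h : R ≤ R') (hh : Rh ≤ Rh') : IsNetwork σ K R' Rh' n f := by
  obtain ⟨F, hF, c, c₀, hc, hc₀, hf⟩ := hf
  exact ⟨F, hF.mono h hh, c, c₀, fun k => (hc k).trans h, hc₀.trans h, hf⟩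

/-- Universal approximation by networks of width `m + 2` and of each large depth, the bound on the
weights depending on the depth. -/
theorem exists_isNetwork_approx {σ : ℝ → ℝ} (hσ : IsAdmissibleActivation σ) {m K : ℕ}
    (hK : m + 2 ≤ K) {S : Set (Fin m → ℝ)} (hS : IsCompact S) {f : (Fin m → ℝ) → ℝ}
    (hf : ContinuousOn f S) {ε : ℝ} (hε : 0 < ε) :
    ∃ n₀, ∀ n ≥ n₀, ∃ R, ∃ f' : (Fin m → ℝ) → ℝ, IsNetwork σ K R R n f' ∧
      ∀ x ∈ S, |f' x - f x| ≤ ε := by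
  have : CompactSpace S := isCompact_iff_compactSpace.1 hS
  obtain ⟨a, ha, -, ha0⟩ := hσ.exists_C1_point
  have hmem : (⟨fun x : S => f x, continuousOn_iff_continuous_domRestrict.1 hf⟩ : C(S, ℝ)) ∈
      (Submodule.span ℝ (range fun q : (Fin m → ℝ) × ℝ =>
        ridgeOn hσ.continuous S q.1 q.2)).topologicalClosure := by
    rw [span_ridgeOn_dense hσ.continuous hσ.not_polynomial hS]
    trivial
  obtain ⟨h, hh, hd⟩ := Metric.mem_closure_iff.1 hmem (ε / 2) (half_pos hε)
  obtain ⟨n₀, hn₀⟩ := exists_isPreActivationLimit_registers hK hσ.continuous ha.self_of_nhds ha0 hh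
  refine ⟨n₀, fun n hn => ?_⟩
  obtain ⟨R, G, hG, hGd⟩ := hn₀ (n + 1) (by omega) (ε / 2) (half_pos hε)
  obtain _ | ⟨hF, W, b, hW, hb⟩ := hG
  rename_i F
  refine ⟨R, _, ⟨F, hF, W ⟨m + 1, by omega⟩, b ⟨m + 1, by omega⟩, hW _, hb _, fun x => rfl⟩,
    fun x hx => ?_⟩
  have h1 := hGd ⟨x, hx⟩ ⟨m + 1, by omega⟩
  have h2 := ContinuousMap.dist_apply_le_dist (f := (⟨fun x : S => f x,
    continuousOn_iff_continuous_domRestrict.1 hf⟩ : C(S, ℝ))) (g := h) ⟨x, hx⟩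
  simp only [registers, Matrix.mulVec, dotProduct] at h1
  simp only [add_lt_iff_neg_left, not_lt_zero, dite_false, Nat.add_eq_left, one_ne_zero,
    if_false] at h1
  rw [dist_comm, Real.dist_eq] at h2
  calc _ ≤ _ := abs_sub_le _ (h ⟨x, hx⟩) _
    _ ≤ ε / 2 + ε / 2 := add_le_add h1 (h2.trans hd.le)
    _ = ε := add_halves ε

/-! ### Approximation with weights bounded uniformly in the depth -/

lemma PreActivation.comp {σ : ℝ → ℝ} {m K : ℕ} {R Rh : ℝ} (hR : R * R + R ≤ Rh) {n₁ n₂ : ℕ}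
    {f : (Fin m → ℝ) → ℝ} (hf : IsNetwork σ K R Rh n₁ f) {G : (Fin 1 → ℝ) → Fin K → ℝ}
    (hG : PreActivation σ R Rh n₂ G) :
    PreActivation σ R Rh (n₁ + n₂ + 1) (fun x => G fun _ => f x) := by
  induction hG with
  | base W b hW hb =>
    obtain ⟨F, hF, c, c₀, hc, hc₀, hf⟩ := hf
    have hR0 : 0 ≤ R := (abs_nonneg _).trans hc₀
    convert PreActivation.step hF (fun k j => W k 0 * c j) (fun k => W k 0 * c₀ + b k)
      (fun k j => ?_) (fun k => ?_) using 3 with x k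
    · simp only [Matrix.mulVec, dotProduct, hf, Fin.sum_univ_one, mul_add, Finset.mul_sum,
        mul_assoc, add_assoc]
    · rw [abs_mul]
      have := mul_le_mul (hW k 0) (hc j) (abs_nonneg _) hR0
      linarith
    · refine (abs_add_le _ _).trans (le_trans ?_ hR)
      rw [abs_mul]
      exact add_le_add (mul_le_mul (hW k 0) hc₀ (abs_nonneg _) hR0) (hb k)
  | step _ W b hW hb ih => exact .step ih W b hW hb

/-- Feeding the output of a network to a network with one input gives a network, and the bound on
the weights does not deteriorate: only the two weight layers at the junction are merged. -/
lemma IsNetwork.comp {σ : ℝ → ℝ} {m K : ℕ} {R Rh : ℝ} (hR : R * R + R ≤ Rh) {n₁ n₂ : ℕ}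
    {f : (Fin m → ℝ) → ℝ} (hf : IsNetwork σ K R Rh n₁ f) {g : (Fin 1 → ℝ) → ℝ}
    (hg : IsNetwork σ K R Rh n₂ g) :
    IsNetwork σ K R Rh (n₁ + n₂ + 1) (fun x => g fun _ => f x) := by
  obtain ⟨G, hG, c, c₀, hc, hc₀, hg⟩ := hg
  exact ⟨_, PreActivation.comp hR hf hG, c, c₀, hc, hc₀, fun x => hg _⟩

/-- The cell number `j` of the latches with resolution `e`: the interval `[e j, e (j + 1)]`,
enlarged by `e / 4` on both sides. -/
def latchCell (e : ℝ) (j : ℤ) : Set ℝ := Icc (e * j - e / 4) (e * j + 5 * e / 4)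

/-- The map `t ↦ t - e sin (2 π t / e) / (2 π)` sends each cell to its interior, with a margin. -/
lemma mem_latchCell_of_near {e : ℝ} (he : 0 < e) {j : ℤ} {t t' : ℝ} (ht : t ∈ latchCell e j)
    (ht' : |t' - (t - e * Real.sin (2 * Real.pi * t / e) / (2 * Real.pi))| ≤ e / 8) :
    t' ∈ latchCell e j := by
  have hπ := Real.pi_pos
  have hmono : ∀ s s' : ℝ, s ≤ s' →
      s - e * Real.sin (2 * Real.pi * s / e) / (2 * Real.pi) ≤
        s' - e * Real.sin (2 * Real.pi * s' / e) / (2 * Real.pi) := by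
    intro s s' hs
    have h1 : Real.sin (2 * Real.pi * s' / e) - Real.sin (2 * Real.pi * s / e) ≤
        2 * Real.pi * (s' - s) / e := by
      have h2 := Real.lipschitzWith_sin.dist_le_mul (2 * Real.pi * s' / e) (2 * Real.pi * s / e)
      rw [Real.dist_eq, Real.dist_eq, NNReal.coe_one, one_mul, ← sub_div, ← mul_sub,
        abs_of_nonneg (a := 2 * Real.pi * (s' - s) / e)
          (div_nonneg (mul_nonneg (by positivity) (sub_nonneg.2 hs)) he.le)] at h2
      exact (le_abs_self _).trans h2
    have h3 : e * Real.sin (2 * Real.pi * s' / e) / (2 * Real.pi) -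
        e * Real.sin (2 * Real.pi * s / e) / (2 * Real.pi) ≤ s' - s := by
      rw [← sub_div, ← mul_sub, div_le_iff₀ (by positivity)]
      calc _ ≤ e * (2 * Real.pi * (s' - s) / e) := by gcongr
        _ = _ := by field_simp
    linarith
  have hmargin : e / 8 ≤ e / (2 * Real.pi) := by
    apply div_le_div_of_nonneg_left he.le (by positivity)
    linarith [Real.pi_le_four]
  have hl : Real.sin (2 * Real.pi * (e * j - e / 4) / e) = -1 := by
    have : 2 * Real.pi * (e * j - e / 4) / e = -(Real.pi / 2) + j * (2 * Real.pi) := by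
      field_simp; ring
    rw [this, Real.sin_add_int_mul_two_pi, Real.sin_neg, Real.sin_pi_div_two]
  have hr : Real.sin (2 * Real.pi * (e * j + 5 * e / 4) / e) = 1 := by
    have : 2 * Real.pi * (e * j + 5 * e / 4) / e =
        Real.pi / 2 + ((j + 1 : ℤ) : ℝ) * (2 * Real.pi) := by
      push_cast; field_simp; ring
    rw [this, Real.sin_add_int_mul_two_pi, Real.sin_pi_div_two]
  have h1 := hmono _ _ ht.1
  have h2 := hmono _ _ ht.2
  rw [hl] at h1
  rw [hr] at h2
  have h3 := abs_le.1 ht'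
  have h4 : e * -1 / (2 * Real.pi) = -(e / (2 * Real.pi)) := by ring
  have h5 : e * 1 / (2 * Real.pi) = e / (2 * Real.pi) := by ring
  rw [h4] at h1
  rw [h5] at h2
  constructor <;> linarith

/-- A latch with resolution `e` preserves all cells contained in `[-1, 2]`. Hence a value passed
through arbitrarily many latches keeps its cell. -/
def IsLatch (e : ℝ) (g : (Fin 1 → ℝ) → ℝ) : Prop :=
  ∀ j : ℤ, latchCell e j ⊆ Icc (-1) 2 → ∀ t ∈ latchCell e j, g (fun _ => t) ∈ latchCell e j

/-- There are latches of each large depth whose weights have a bound independent of the depth: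
those of depths between `n₀` and `2 n₀` are composed to latches of larger depths. -/
lemma exists_isNetwork_isLatch {σ : ℝ → ℝ} (hσ : IsAdmissibleActivation σ) {K : ℕ} (hK : 3 ≤ K)
    {e : ℝ} (he : 0 < e) :
    ∃ (n₀ : ℕ) (R₁ : ℝ), ∀ R Rh : ℝ, R₁ ≤ R → R * R + R ≤ Rh → ∀ n ≥ n₀,
      ∃ g : (Fin 1 → ℝ) → ℝ, IsNetwork σ K R Rh n g ∧ IsLatch e g := by
  have hcont : Continuous fun t : Fin 1 → ℝ =>
    t 0 - e * Real.sin (2 * Real.pi * t 0 / e) / (2 * Real.pi) := by fun_prop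
  have hS : IsCompact (univ.pi fun _ : Fin 1 => Icc (-1 : ℝ) 2) :=
    isCompact_univ_pi fun _ => isCompact_Icc
  obtain ⟨n₀, hn₀⟩ := exists_isNetwork_approx hσ (m := 1) (K := K) hK hS hcont.continuousOn
    (show 0 < e / 8 by positivity)
  have hbase : ∀ n ≥ n₀, ∃ R, ∃ g : (Fin 1 → ℝ) → ℝ, IsNetwork σ K R R n g ∧ IsLatch e g := by
    intro n hn
    obtain ⟨R, g, hg, hgd⟩ := hn₀ n hn
    refine ⟨R, g, hg, fun j hj t ht => mem_latchCell_of_near he ht ?_⟩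
    exact hgd (fun _ => t) (fun _ _ => hj ht)
  choose! ρ g hg hgl using hbase
  obtain ⟨R₁, hR₁⟩ := ((finite_Icc n₀ (2 * n₀)).image ρ).bddAbove
  refine ⟨n₀, R₁, fun R Rh hR hRh n hn => ?_⟩
  have hRRh : R ≤ Rh := by nlinarith [mul_self_nonneg R]
  have hsmall : ∀ n, n₀ ≤ n → n ≤ 2 * n₀ → IsNetwork σ K R Rh n (g n) := fun n h1 h2 => by
    have h3 : ρ n ≤ R := (hR₁ ⟨n, ⟨h1, h2⟩, rfl⟩).trans hR
    exact (hg n h1).mono h3 (h3.trans hRRh)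
  induction n using Nat.strong_induction_on with
  | _ n ih =>
  rcases le_or_gt n (2 * n₀) with h | h
  · exact ⟨g n, hsmall n hn h, hgl n hn⟩
  · obtain ⟨g', hg', hgl'⟩ := ih (n - n₀ - 1) (by omega) (by omega)
    refine ⟨fun x => g' fun _ => g n₀ x, ?_, fun j hj t ht =>
      hgl' j hj _ (hgl n₀ le_rfl j hj t ht)⟩
    have hcomp := (hsmall n₀ le_rfl (by omega)).comp hRh hg'
    rwa [show n₀ + (n - n₀ - 1) + 1 = n by omega] at hcomp

/-- Universal approximation by networks of width `m + 2` and of each large depth, with a bound on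
the weights independent of the depth. -/
theorem exists_isNetwork_approx_uniform {σ : ℝ → ℝ} (hσ : IsAdmissibleActivation σ) {m K : ℕ}
    (hm : 1 ≤ m) (hK : m + 2 ≤ K) {S : Set (Fin m → ℝ)} (hS : IsCompact S)
    {f : (Fin m → ℝ) → ℝ} (hf : ContinuousOn f S) (hf01 : ∀ x ∈ S, f x ∈ Icc (0 : ℝ) 1)
    {ε : ℝ} (hε : 0 < ε) :
    ∃ (n₀ : ℕ) (R : ℝ), ∀ n ≥ n₀, ∃ f' : (Fin m → ℝ) → ℝ, IsNetwork σ K R R n f' ∧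
      ∀ x ∈ S, |f' x - f x| ≤ ε := by
  set e : ℝ := min (ε / 2) (1 / 2) with he
  have he0 : 0 < e := by positivity
  have he1 : e ≤ 1 / 2 := min_le_right _ _
  have he2 : e ≤ ε / 2 := min_le_left _ _
  obtain ⟨n₁, hn₁⟩ := exists_isNetwork_approx hσ hK hS hf (show 0 < e / 4 by positivity)
  obtain ⟨R₁, f₁, hf₁, hd₁⟩ := hn₁ n₁ le_rfl
  obtain ⟨n₂, R₂, hR₂⟩ := exists_isNetwork_isLatch hσ (K := K) (by omega) he0
  set R : ℝ := max R₁ (max R₂ 0) with hR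
  have hR0 : 0 ≤ R := (le_max_right _ _).trans (le_max_right _ _)
  have hRR : R ≤ R * R + R := by nlinarith
  refine ⟨n₁ + n₂ + 1, R * R + R, fun n hn => ?_⟩
  obtain ⟨g, hg, hgl⟩ := hR₂ R (R * R + R) ((le_max_left _ _).trans (le_max_right _ _)) le_rfl
    (n - n₁ - 1) (by omega)
  have hcomp := ((hf₁.mono (le_max_left _ _) ((le_max_left _ _).trans hRR)).comp le_rfl hg).mono
    hRR le_rfl
  refine ⟨_, by convert hcomp using 1; omega, fun x hx => ?_⟩
  set j : ℤ := ⌊f x / e⌋ with hj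
  have hj1 : e * j ≤ f x := by
    have := (le_div_iff₀ he0).1 (Int.floor_le (f x / e))
    linarith
  have hj2 : f x ≤ e * j + e := by
    have := (div_lt_iff₀ he0).1 (Int.lt_floor_add_one (f x / e))
    linarith
  have hj0 : (0 : ℝ) ≤ e * j :=
    mul_nonneg he0.le (by exact_mod_cast Int.floor_nonneg.2 (div_nonneg (hf01 x hx).1 he0.le))
  have hx1 := (hf01 x hx).2
  have hd := abs_le.1 (hd₁ x hx)
  have hmem := hgl j (Icc_subset_Icc (by linarith) (by linarith)) (f₁ x)
    ⟨by linarith, by linarith⟩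
  rw [abs_le]
  constructor <;> linarith [hmem.1, hmem.2]

lemma PreActivation.exists_netParams {σ : ℝ → ℝ} {d K n : ℕ} {R : ℝ} (hR : 0 ≤ R)
    {F : (Fin d → ℝ) → Fin K → ℝ} (hF : PreActivation σ R R n F) :
    ∃ w : NetParams d (n + 1) K, w.BoundedBy R ∧
      ∀ (x : Input d) k, w.hidden σ x n k = σ (F x.ofLp k) := by
  induction hF with
  | base W b hW hb =>
    refine ⟨⟨W, b, fun _ => 0, fun _ => 0, 0, 0⟩, ⟨hW, hb, ?_, ?_, ?_, ?_⟩, fun x k => rfl⟩ <;>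
      simp [hR]
  | step hF W b hW hb ih =>
    rename_i n F
    obtain ⟨w, ⟨h1, h2, h3, h4, -, -⟩, hw⟩ := ih
    let w' : NetParams d (n + 2) K :=
      ⟨w.inW, w.inB, fun i => if h : i.1 < n then w.hidW ⟨i.1, h⟩ else W,
        fun i => if h : i.1 < n then w.hidB ⟨i.1, h⟩ else b, 0, 0⟩
    have hsame : ∀ (x : Input d) i, i ≤ n → w'.hidden σ x i = w.hidden σ x i := by
      intro x i
      induction i with
      | zero => intro _; rfl
      | succ i ih =>
        intro hi
        have hi1 : i < n + 1 - 1 := by omega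
        have hi2 : i < n + 2 - 1 := by omega
        have hi3 : i < n := by omega
        simp only [NetParams.hidden, hi1, hi2, dif_pos, ih (by omega)]
        simp [w', hi3]
    refine ⟨w', ⟨h1, h2, fun i k j => ?_, fun i k => ?_, by simp [w', hR], by simp [w', hR]⟩,
      fun x k => ?_⟩
    · by_cases h : i.1 < n
      · simpa [w', h] using h3 ⟨i.1, h⟩ k j
      · simpa [w', h] using hW k j
    · by_cases h : i.1 < n
      · simpa [w', h] using h4 ⟨i.1, h⟩ k
      · simpa [w', h] using hb k
    · have hn : n < n + 2 - 1 := by omega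
      have hv : w.hidden σ x n = fun j => σ (F x.ofLp j) := funext (hw x)
      simp only [NetParams.hidden, hn, dif_pos, hsame x n le_rfl, hv]
      simp [w']

lemma IsNetwork.exists_netParams {σ : ℝ → ℝ} {d K n : ℕ} {R : ℝ} {f : (Fin d → ℝ) → ℝ}
    (hf : IsNetwork σ K R R n f) :
    ∃ w : NetParams d (n + 1) K, w.BoundedBy R ∧ ∀ x : Input d, w.eval σ x = f x.ofLp := by
  obtain ⟨F, hF, c, c₀, hc, hc₀, hf⟩ := hf
  obtain ⟨w, ⟨h1, h2, h3, h4, -, -⟩, hw⟩ := hF.exists_netParams ((abs_nonneg _).trans hc₀)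
  let w' : NetParams d (n + 1) K := { w with outW := c, outB := c₀ }
  have hsame : ∀ (x : Input d) i, w'.hidden σ x i = w.hidden σ x i := by
    intro x i
    induction i with
    | zero => rfl
    | succ i ih => simp only [NetParams.hidden, ih]; rfl
  refine ⟨w', ⟨h1, h2, h3, h4, hc, hc₀⟩, fun x => ?_⟩
  rw [hf, NetParams.eval]
  simp only [Nat.add_sub_cancel, hsame, hw]
  rfl

/-- The families `FFNN_{H,K}(R)` with `K ≥ d + 2` approximate each continuous function with values
in `[0, 1]`, uniformly in `H ≥ H₀` and `R ≥ R₀`. -/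
theorem exists_ffnnParams_approx {d : ℕ} (hd : 1 ≤ d) {X : Set (Input d)} (hX : IsCompact X)
    {K : ℕ} (hK : d + 2 ≤ K) {σ : ℝ → ℝ} (hσ : IsAdmissibleActivation σ) {f : Input d → ℝ}
    (hf : Continuous f) (hf01 : ∀ x, f x ∈ Icc (0 : ℝ) 1) {ε : ℝ} (hε : 0 < ε) :
    ∃ (R₀ : ℝ) (H₀ : ℕ), ∀ H ≥ H₀, ∀ R ≥ R₀, ∃ w ∈ ffnnParams X σ H K R,
      ∀ x ∈ X, |w.eval σ x - f x| ≤ ε := by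
  set e : ℝ := min (ε / 2) (1 / 2) with he
  have he0 : 0 < e := by positivity
  have he1 : e ≤ 1 / 2 := min_le_right _ _
  have he2 : e ≤ ε / 2 := min_le_left _ _
  -- the target is moved away from `0` and `1`, so that its approximations stay in `[0, 1]`
  let f₁ : (Fin d → ℝ) → ℝ := fun x => e + (1 - 2 * e) * f (WithLp.toLp 2 x)
  have hcf₁ : Continuous f₁ := by
    have : Continuous fun x : Fin d → ℝ => f (WithLp.toLp 2 x) :=
      hf.comp (PiLp.continuous_toLp 2 _)
    fun_prop
  have hf₁ : ∀ x, f₁ x ∈ Icc e (1 - e) := fun x => by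
    have h := hf01 (WithLp.toLp 2 x)
    constructor <;> simp only [f₁] <;> nlinarith [h.1, h.2]
  have hS : IsCompact (WithLp.ofLp '' X) := hX.image (PiLp.continuous_ofLp 2 _)
  obtain ⟨n₀, R₀, hn₀⟩ := exists_isNetwork_approx_uniform hσ hd hK hS hcf₁.continuousOn
    (fun x _ => ⟨he0.le.trans (hf₁ x).1, (hf₁ x).2.trans (by linarith)⟩) he0
  refine ⟨R₀, n₀ + 1, fun H hH R hR => ?_⟩
  obtain ⟨n, rfl⟩ : ∃ n, H = n + 1 := ⟨H - 1, by omega⟩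
  obtain ⟨f', hf', hd'⟩ := hn₀ n (by omega)
  obtain ⟨w, hw, hwf⟩ := (hf'.mono hR hR).exists_netParams
  have hdw : ∀ x ∈ X, |w.eval σ x - f₁ x.ofLp| ≤ e := fun x hx => by
    rw [hwf]; exact hd' _ ⟨x, hx, rfl⟩
  refine ⟨w, ⟨hw, fun x hx => ?_⟩, fun x hx => ?_⟩
  · have h1 := abs_le.1 (hdw x hx)
    have h2 := hf₁ x.ofLp
    exact ⟨by linarith [h2.1], by linarith [h2.2]⟩
  · have h1 := abs_le.1 (hdw x hx)
    have h2 := hf01 x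
    have h3 : f₁ x.ofLp = e + (1 - 2 * e) * f x := rfl
    rw [h3] at h1
    rw [abs_le]
    constructor <;> nlinarith [h2.1, h2.2]

/-! ### Limits of averages over pruned samples -/

section Score

variable {d : ℕ} {X : Set (Input d)} {μ : Measure (Sample d)} {p : Input d → ℝ}
  {g : Sample d → ℝ}

lemma isCompact_dataSpace (hX : IsCompact X) : IsCompact (dataSpace X) :=
  hX.prod (Set.toFinite _).isCompact

lemma measurableSet_dataSpace (hX : IsCompact X) : MeasurableSet (dataSpace X) :=
  (isCompact_dataSpace hX).isClosed.measurableSet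

lemma IsBinaryProcess.ae_mem (hμ : IsBinaryProcess X μ p) : ∀ᵐ z ∂μ, z ∈ dataSpace X :=
  hμ.concentrated

open scoped Classical in
lemma IsAdapted.measurable_indicator (hX : IsCompact X) (hg : IsAdapted X g) :
    Measurable ((dataSpace X).indicator g) := by
  rw [← Set.piecewise_eq_indicator]
  exact hg.1.measurable_piecewise continuousOn_const (measurableSet_dataSpace hX)

/-- The law of an adapted score has no atoms. -/
lemma IsAdapted.measure_level_eq_zero (hX : IsCompact X) (hμ : IsBinaryProcess X μ p)
    (hg : IsAdapted X g) (c : ℝ) : μ {z | (dataSpace X).indicator g z = c} = 0 := by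
  set L : Set (Sample d) := {z ∈ dataSpace X | g z = c} with hL
  have hL0 : dataLebesgue X L = 0 := by
    by_cases hc : c ∈ g '' dataSpace X
    · exact hg.2 c hc
    · have : L = ∅ := by
        ext z
        simp only [hL, mem_ofPred_eq, mem_empty_iff_false, iff_false, not_and]
        exact fun hz hgz => hc ⟨z, hz, hgz⟩
      simp [this]
  have h1 := Measure.measure_ae_null_of_prod_null hL0
  have h2 : ∀ᵐ x ∂(volume : Measure (Input d)), x ∈ X → (x, (0 : ℝ)) ∉ L ∧ (x, (1 : ℝ)) ∉ L := by
    filter_upwards [(ae_restrict_iff' hX.isClosed.measurableSet).1 h1] with x hx hxX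
    have h3 := hx hxX
    simp only [Pi.zero_apply, Measure.coe_add, Pi.add_apply, add_eq_zero] at h3
    constructor
    · intro h
      have := Measure.dirac_apply_of_mem (show (0 : ℝ) ∈ Prod.mk x ⁻¹' L from h)
      rw [h3.1] at this
      exact zero_ne_one this
    · intro h
      have := Measure.dirac_apply_of_mem (show (1 : ℝ) ∈ Prod.mk x ⁻¹' L from h)
      rw [h3.2] at this
      exact zero_ne_one this
  have h3 := ae_of_ae_map measurable_fst.aemeasurable (hμ.marginal_ac.ae_le h2)
  have h4 : ∀ᵐ z ∂μ, (dataSpace X).indicator g z ≠ c := ?_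
  · simpa using ae_iff.1 h4
  filter_upwards [h3, hμ.ae_mem] with z hz hzD hgz
  rw [indicator_of_mem hzD] at hgz
  obtain ⟨hz0, hz1⟩ := hz hzD.1
  have hzL : z ∈ L := ⟨hzD, hgz⟩
  obtain ⟨x, y⟩ := z
  rcases hzD.2 with h | h
  · simp only at h; subst h; exact hz0 hzL
  · simp only [mem_singleton_iff] at h; subst h; exact hz1 hzL

/-- In dimension `0` there are no adapted scores: the data space is finite. -/
lemma IsAdapted.one_le_dim [IsProbabilityMeasure μ] (hX : IsCompact X)
    (hμ : IsBinaryProcess X μ p) (hg : IsAdapted X g) : 1 ≤ d := by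
  by_contra! hd
  obtain rfl : d = 0 := by omega
  have hfin : (dataSpace X).Finite := (Set.toFinite X).prod (Set.toFinite _)
  have h0 : μ (dataSpace X) = 0 := by
    rw [← biUnion_of_singleton (dataSpace X), measure_biUnion_null_iff hfin.countable]
    exact fun z _ => measure_mono_null (by rintro _ rfl; rfl)
      (hg.measure_level_eq_zero hX hμ ((dataSpace X).indicator g z))
  have h1 : μ univ = 0 := by
    rw [← union_compl_self (dataSpace X)]
    exact measure_union_null h0 hμ.concentrated
  simp at h1

variable [IsProbabilityMeasure μ]

lemma ae_iidLaw_forall {q : Sample d → Prop} (hq : ∀ᵐ z ∂μ, q z) :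
    ∀ᵐ ω ∂iidLaw μ, ∀ i, q (ω i) :=
  ae_all_iff.2 fun i => (measurePreserving_eval_infinitePi (fun _ : ℕ => μ)
    i).quasiMeasurePreserving.ae hq

lemma ae_iidLaw_injective_score (hX : IsCompact X) (hμ : IsBinaryProcess X μ p)
    (hg : IsAdapted X g) :
    ∀ᵐ ω ∂iidLaw μ, Function.Injective fun i => (dataSpace X).indicator g (ω i) := by
  have hm := hg.measurable_indicator hX
  have hE : MeasurableSet {q : Sample d × Sample d |
      (dataSpace X).indicator g q.1 = (dataSpace X).indicator g q.2} :=
    measurableSet_eq_fun (hm.comp measurable_fst) (hm.comp measurable_snd)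
  have h0 : (μ.prod μ) {q : Sample d × Sample d |
      (dataSpace X).indicator g q.1 = (dataSpace X).indicator g q.2} = 0 := by
    rw [Measure.measure_prod_null hE]
    refine Eventually.of_forall fun z => ?_
    rw [Pi.zero_apply, ← hg.measure_level_eq_zero hX hμ ((dataSpace X).indicator g z)]
    exact congrArg μ (by ext z'; exact eq_comm)
  have h1 : ∀ i j : ℕ, i ≠ j → ∀ᵐ ω ∂iidLaw μ,
      (dataSpace X).indicator g (ω i) ≠ (dataSpace X).indicator g (ω j) := by
    intro i j hij
    rw [← Measure.infinitePi_map_eval_prod (P := fun _ : ℕ => μ) hij,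
      Measure.map_apply (by fun_prop) hE] at h0
    exact ae_iff.2 (by simpa [iidLaw] using h0)
  have h2 : ∀ᵐ ω ∂iidLaw μ, ∀ i j : ℕ, i ≠ j →
      (dataSpace X).indicator g (ω i) ≠ (dataSpace X).indicator g (ω j) := by
    simp only [ae_all_iff]
    exact h1
  filter_upwards [h2] with ω hω i j h
  by_contra hij
  exact hω i j hij h

/-- The strong law of large numbers for bounded functions of the samples. -/
lemma ae_iidLaw_tendsto_average {φ : Sample d → ℝ} (hφ : Measurable φ) {C : ℝ}
    (hC : ∀ z, |φ z| ≤ C) :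
    ∀ᵐ ω ∂iidLaw μ, Tendsto (fun n : ℕ => (∑ i ∈ Finset.range n, φ (ω i)) / n) atTop
      (𝓝 (∫ z, φ z ∂μ)) := by
  have hmp := fun i => measurePreserving_eval_infinitePi (fun _ : ℕ => μ) i
  have hint : Integrable φ μ := Integrable.of_bound hφ.aestronglyMeasurable C
    (Eventually.of_forall fun z => by simpa using hC z)
  have h := ProbabilityTheory.strong_law_ae_real (μ := iidLaw μ) (fun i ω => φ (ω i))
    ((hmp 0).integrable_comp_of_integrable hint)
    (fun i j hij => (ProbabilityTheory.iIndepFun_infinitePi (P := fun _ : ℕ => μ)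
      (X := fun _ => φ) (fun _ => hφ)).indepFun hij)
    (fun i => ⟨(hφ.comp (measurable_pi_apply i)).aemeasurable,
      (hφ.comp (measurable_pi_apply 0)).aemeasurable, by
        have h1 : ∀ i : ℕ, Measure.map (fun ω : ℕ → Sample d => φ (ω i)) (iidLaw μ) =
            Measure.map φ μ := fun i => by
          conv_rhs => rw [← (hmp i).map_eq, Measure.map_map hφ (hmp i).measurable]
          rfl
        rw [h1, h1]⟩)
  have h2 : ∫ ω, φ (ω 0) ∂iidLaw μ = ∫ z, φ z ∂μ := by
    have := (hmp 0).map_eq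
    conv_rhs => rw [← this]
    rw [integral_map (hmp 0).measurable.aemeasurable (by rw [this]; exact hφ.aestronglyMeasurable)]
    rfl
  rw [← h2]
  exact h

end Score

/-- The average of a function over a finite set of samples. -/
def sampleAverage {d : ℕ} (S : Finset (Sample d)) (φ : Sample d → ℝ) : ℝ :=
  (∑ z ∈ S, φ z) / (S.card : ℝ)

lemma abs_sampleAverage_sub_le {d : ℕ} {S : Finset (Sample d)} {φ ψ : Sample d → ℝ} {C : ℝ}
    (hC0 : 0 ≤ C) (hC : ∀ z ∈ S, |φ z - ψ z| ≤ C) :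
    |sampleAverage S φ - sampleAverage S ψ| ≤ C := by
  rw [sampleAverage, sampleAverage, ← sub_div, ← Finset.sum_sub_distrib, abs_div, Nat.abs_cast]
  refine div_le_of_le_mul₀ (Nat.cast_nonneg _) hC0 ?_
  calc |∑ z ∈ S, (φ z - ψ z)| ≤ ∑ z ∈ S, |φ z - ψ z| := Finset.abs_sum_le_sum_abs _ _
    _ ≤ ∑ z ∈ S, C := Finset.sum_le_sum hC
    _ = C * S.card := by rw [Finset.sum_const, nsmul_eq_mul, mul_comm]

lemma abs_sum_sub_sum_le_of_subset {α : Type*} [DecidableEq α] {S T : Finset α} (h : S ⊆ T)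
    {φ : α → ℝ} {C : ℝ} (hC : ∀ z, |φ z| ≤ C) :
    |∑ z ∈ T, φ z - ∑ z ∈ S, φ z| ≤ C * |(T.card : ℝ) - S.card| := by
  rw [← Finset.sum_sdiff_eq_sub h, ← Nat.cast_sub (Finset.card_le_card h),
    ← Finset.card_sdiff_of_subset h, Nat.abs_cast]
  calc |∑ z ∈ T \ S, φ z| ≤ ∑ z ∈ T \ S, |φ z| := Finset.abs_sum_le_sum_abs _ _
    _ ≤ ∑ z ∈ T \ S, C := Finset.sum_le_sum fun z _ => hC z
    _ = C * (T \ S).card := by rw [Finset.sum_const, nsmul_eq_mul, mul_comm]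

/-- Two sublevel sets of the same score are nested, so that sums over them differ by at most the
difference of their cardinalities. -/
lemma abs_sum_filter_le_sub_sum_filter_le {α : Type*} (Z : Finset α) (g : α → ℝ)
    (s t : ℝ) {φ : α → ℝ} {C : ℝ} (hC : ∀ z, |φ z| ≤ C) :
    |∑ z ∈ Z with g z ≤ s, φ z - ∑ z ∈ Z with g z ≤ t, φ z| ≤
      C * |((Z.filter (g · ≤ s)).card : ℝ) - (Z.filter (g · ≤ t)).card| := by
  classical
  rcases le_total s t with h | h
  · rw [abs_sub_comm, abs_sub_comm (Nat.cast _)]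
    exact abs_sum_sub_sum_le_of_subset
      (Finset.monotone_filter_right _ fun z _ hz => hz.trans h) hC
  · exact abs_sum_sub_sum_le_of_subset
      (Finset.monotone_filter_right _ fun z _ hz => hz.trans h) hC

section Pruned

variable {d : ℕ} {X : Set (Input d)} {μ : Measure (Sample d)} [IsProbabilityMeasure μ]
  {p : Input d → ℝ} {g : Sample d → ℝ} {A : Finset (Sample d) → ℝ → Finset (Sample d)}

/-- At the compression level `r = μ {g ≤ c}`, averages over the pruned samples converge to the mean
over `{g ≤ c}`. The samples kept and those with `g ≤ c` are sublevel sets of `g` of asymptotically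
the same cardinality `r n`. -/
lemma ae_tendsto_pruned_average (hX : IsCompact X) (hμ : IsBinaryProcess X μ p)
    (hA : IsPruningAlgorithm X A) (hg : IsAdapted X g) (hAg : IsScoreBased X g A) {c r : ℝ}
    (hr : r = μ.real {z | (dataSpace X).indicator g z ≤ c}) (hr01 : r ∈ Ioo (0 : ℝ) 1)
    {φ : Sample d → ℝ} (hφ : Measurable φ) {C : ℝ} (hC : ∀ z, |φ z| ≤ C) :
    ∀ᵐ ω ∂iidLaw μ, Tendsto (fun n => sampleAverage (A (firstSamples ω n) r) φ) atTop
      (𝓝 ((∫ z in {z | (dataSpace X).indicator g z ≤ c}, φ z ∂μ) / r)) := by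
  classical
  set G := (dataSpace X).indicator g with hG
  have hGm : Measurable G := hg.measurable_indicator hX
  set Q : Set (Sample d) := {z | G z ≤ c} with hQ
  have hQm : MeasurableSet Q := measurableSet_le hGm measurable_const
  have hC0 : 0 ≤ C := (abs_nonneg _).trans (hC 0)
  have h1 := ae_iidLaw_tendsto_average (μ := μ) (φ := Q.indicator φ) (hφ.indicator hQm) (C := C)
    (fun z => by by_cases hz : z ∈ Q <;> simp [hz, hC, hC0])
  have h2 := ae_iidLaw_tendsto_average (μ := μ) (φ := Q.indicator fun _ => 1)
    (measurable_const.indicator hQm) (C := 1)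
    (fun z => by by_cases hz : z ∈ Q <;> simp [hz])
  filter_upwards [h1, h2, ae_iidLaw_forall hμ.ae_mem, ae_iidLaw_injective_score hX hμ hg]
    with ω hω1 hω2 hωD hωg
  rw [integral_indicator hQm] at hω1 hω2
  rw [integral_const, measureReal_restrict_apply_univ, smul_eq_mul, mul_one, ← hr] at hω2
  have hinj : Function.Injective ω := fun i j hij => hωg (by simp only [hij])
  have hcard : ∀ n, (firstSamples ω n).card = n := fun n => by
    rw [firstSamples, Finset.card_image_of_injective _ hinj, Finset.card_range]
  have hsub : ∀ n, (firstSamples ω n : Set (Sample d)) ⊆ dataSpace X := fun n => by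
    intro z hz
    obtain ⟨i, -, rfl⟩ := Finset.mem_image.1 (Finset.mem_coe.1 hz)
    exact hωD i
  have hGg : ∀ n, ∀ z ∈ firstSamples ω n, G z = g z := fun n z hz =>
    indicator_of_mem (hsub n hz) g
  have hsum : ∀ n (ψ : Sample d → ℝ), ∑ z ∈ firstSamples ω n with G z ≤ c, ψ z =
      ∑ i ∈ Finset.range n, Q.indicator ψ (ω i) := fun n ψ => by
    rw [Finset.sum_filter, firstSamples, Finset.sum_image hinj.injOn]
    rfl
  have hgInj : ∀ n, InjOn g (firstSamples ω n : Set (Sample d)) := fun n => by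
    intro z hz z' hz' h
    rw [← hGg n z hz, ← hGg n z' hz'] at h
    obtain ⟨i, -, rfl⟩ := Finset.mem_image.1 (Finset.mem_coe.1 hz)
    obtain ⟨j, -, rfl⟩ := Finset.mem_image.1 (Finset.mem_coe.1 hz')
    rw [hωg h]
  have hbig : ∀ᶠ n : ℕ in atTop, 1 ≤ r * (n : ℝ) := by
    have := (tendsto_natCast_atTop_atTop (R := ℝ)).const_mul_atTop hr01.1
    exact this.eventually_ge_atTop 1
  have hk : Tendsto (fun n : ℕ => (⌊r * (n : ℝ)⌋₊ : ℝ) / n) atTop (𝓝 r) :=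
    (tendsto_nat_floor_mul_div_atTop hr01.1.le).comp tendsto_natCast_atTop_atTop
  have hAcard : ∀ n : ℕ, 1 ≤ r * (n : ℝ) → (A (firstSamples ω n) r).card = ⌊r * (n : ℝ)⌋₊ :=
    fun n hn => by
      have := (hA _ (hsub n) r ⟨hr01.1, hr01.2.le⟩).2
      rw [hcard] at this
      exact this hn
  have hdiff : ∀ᶠ n : ℕ in atTop, ‖(∑ z ∈ A (firstSamples ω n) r, φ z) / n -
      (∑ i ∈ Finset.range n, Q.indicator φ (ω i)) / n‖ ≤ C * |(⌊r * (n : ℝ)⌋₊ : ℝ) / n -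
        (∑ i ∈ Finset.range n, Q.indicator (fun _ => (1 : ℝ)) (ω i)) / n| := by
    filter_upwards [hbig] with n hn
    obtain ⟨t, ht⟩ : ∃ t, A (firstSamples ω n) r = (firstSamples ω n).filter (G · ≤ t) := by
      refine ⟨orderStatistic g (firstSamples ω n) ⌊r * ((firstSamples ω n).card : ℝ)⌋₊,
        (hAg _ (hsub n) (hgInj n) r hr01 (by rwa [hcard])).trans ?_⟩
      ext z
      simp only [Finset.mem_filter]
      exact and_congr_right fun hz => by rw [hGg n z hz]
    have h3 := abs_sum_filter_le_sub_sum_filter_le (firstSamples ω n) G t c hC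
    rw [← ht, hAcard n hn, hsum] at h3
    have h4 : ((Finset.filter (G · ≤ c) (firstSamples ω n)).card : ℝ) =
        ∑ i ∈ Finset.range n, Q.indicator (fun _ => (1 : ℝ)) (ω i) := by
      rw [← hsum, Finset.sum_const, nsmul_eq_mul, mul_one]
    rw [h4] at h3
    rw [← sub_div, ← sub_div, norm_div, abs_div, Real.norm_eq_abs, Real.norm_natCast, Nat.abs_cast,
      ← mul_div_assoc]
    gcongr
  have hlim0 : Tendsto (fun n : ℕ => (∑ z ∈ A (firstSamples ω n) r, φ z) / n -
      (∑ i ∈ Finset.range n, Q.indicator φ (ω i)) / n) atTop (𝓝 0) := by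
    refine squeeze_zero_norm' hdiff ?_
    have := (hk.sub hω2).abs.const_mul C
    simpa using this
  have hlim1 : Tendsto (fun n : ℕ => (∑ z ∈ A (firstSamples ω n) r, φ z) / n) atTop
      (𝓝 (∫ z in Q, φ z ∂μ)) := by
    simpa using hlim0.add hω1
  refine (hlim1.div hk hr01.1.ne').congr' ?_
  filter_upwards [hbig] with n hn
  have hn0 : (n : ℝ) ≠ 0 := by rintro h; rw [h] at hn; norm_num at hn
  rw [Pi.div_apply, sampleAverage, hAcard n hn]
  field_simp

/-- The extension by zero of a function on the data space. -/
def extendData (φ : C(dataSpace X, ℝ)) : Sample d → ℝ := Function.extend Subtype.val φ 0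

lemma extendData_apply (φ : C(dataSpace X, ℝ)) {z : Sample d} (hz : z ∈ dataSpace X) :
    extendData φ z = φ ⟨z, hz⟩ :=
  Subtype.val_injective.extend_apply φ 0 ⟨z, hz⟩

lemma measurable_extendData (hX : IsCompact X) (φ : C(dataSpace X, ℝ)) :
    Measurable (extendData φ) :=
  (MeasurableEmbedding.subtype_coe (measurableSet_dataSpace hX)).measurable_extend
    φ.continuous.measurable measurable_const

lemma abs_extendData_le [CompactSpace (dataSpace X)] (φ : C(dataSpace X, ℝ)) (z : Sample d) :
    |extendData φ z| ≤ ‖φ‖ := by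
  by_cases hz : z ∈ dataSpace X
  · rw [extendData_apply φ hz]
    exact φ.norm_coe_le_norm _
  · rw [extendData, Function.extend_apply' _ _ _ (by simpa using hz)]
    simp

lemma extendData_sub (φ ψ : C(dataSpace X, ℝ)) (z : Sample d) :
    extendData φ z - extendData ψ z = extendData (φ - ψ) z := by
  by_cases hz : z ∈ dataSpace X
  · simp [extendData_apply _ hz]
  · have h : ¬ ∃ a : dataSpace X, a.1 = z := by simpa using hz
    simp [extendData, Function.extend_apply' _ _ _ h]

lemma abs_setIntegral_extendData_sub_le [CompactSpace (dataSpace X)] (hX : IsCompact X)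
    (φ ψ : C(dataSpace X, ℝ)) (Q : Set (Sample d)) :
    |∫ z in Q, extendData φ z ∂μ - ∫ z in Q, extendData ψ z ∂μ| ≤ ‖φ - ψ‖ := by
  have hint : ∀ φ : C(dataSpace X, ℝ), Integrable (extendData φ) (μ.restrict Q) := fun φ =>
    Integrable.of_bound (measurable_extendData hX φ).aestronglyMeasurable ‖φ‖
      (Eventually.of_forall fun z => abs_extendData_le φ z)
  rw [← integral_sub (hint φ) (hint ψ)]
  simp only [extendData_sub]
  have h1 := norm_integral_le_of_norm_le_const (μ := μ.restrict Q) (f := extendData (φ - ψ))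
    (C := ‖φ - ψ‖)
    (Eventually.of_forall fun z => abs_extendData_le (φ - ψ) z)
  refine h1.trans (mul_le_of_le_one_right (norm_nonneg _) ?_)
  rw [measureReal_restrict_apply_univ]
  exact measureReal_le_one

/-- Almost surely, `ae_tendsto_pruned_average` holds for all continuous functions on the data space
simultaneously, since they form a separable space. -/
lemma ae_forall_tendsto_pruned_average (hX : IsCompact X) (hμ : IsBinaryProcess X μ p)
    (hA : IsPruningAlgorithm X A) (hg : IsAdapted X g) (hAg : IsScoreBased X g A) {c r : ℝ}
    (hr : r = μ.real {z | (dataSpace X).indicator g z ≤ c}) (hr01 : r ∈ Ioo (0 : ℝ) 1) :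
    ∀ᵐ ω ∂iidLaw μ, ∀ φ : C(dataSpace X, ℝ),
      Tendsto (fun n => sampleAverage (A (firstSamples ω n) r) (extendData φ)) atTop
        (𝓝 ((∫ z in {z | (dataSpace X).indicator g z ≤ c}, extendData φ z ∂μ) / r)) := by
  have : CompactSpace (dataSpace X) := isCompact_iff_compactSpace.1 (isCompact_dataSpace hX)
  obtain ⟨T, hTc, hTd⟩ := TopologicalSpace.exists_countable_dense C(dataSpace X, ℝ)
  have h1 : ∀ᵐ ω ∂iidLaw μ, ∀ φ ∈ T,
      Tendsto (fun n => sampleAverage (A (firstSamples ω n) r) (extendData φ)) atTop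
        (𝓝 ((∫ z in {z | (dataSpace X).indicator g z ≤ c}, extendData φ z ∂μ) / r)) :=
    (ae_ball_iff hTc).2 fun φ _ => ae_tendsto_pruned_average hX hμ hA hg hAg hr hr01
      (measurable_extendData hX φ) (abs_extendData_le φ)
  filter_upwards [h1] with ω hω φ
  rw [Metric.tendsto_atTop]
  intro ε hε
  have hr0 := hr01.1
  obtain ⟨ψ, hψT, hψ⟩ := hTd.exists_dist_lt φ (show 0 < min (ε / 3) (r * (ε / 3)) by positivity)
  obtain ⟨N, hN⟩ := Metric.tendsto_atTop.1 (hω ψ hψT) (ε / 3) (by positivity)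
  refine ⟨N, fun n hn => ?_⟩
  have h2 := hN n hn
  rw [dist_eq_norm] at hψ
  have h3 : |sampleAverage (A (firstSamples ω n) r) (extendData φ) -
      sampleAverage (A (firstSamples ω n) r) (extendData ψ)| ≤ ‖φ - ψ‖ :=
    abs_sampleAverage_sub_le (norm_nonneg _) fun z _ => by
      rw [extendData_sub]; exact abs_extendData_le _ z
  have h4 := abs_setIntegral_extendData_sub_le (μ := μ) hX φ ψ
    {z | (dataSpace X).indicator g z ≤ c}
  have h5 : |(∫ z in {z | (dataSpace X).indicator g z ≤ c}, extendData φ z ∂μ) / r -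
      (∫ z in {z | (dataSpace X).indicator g z ≤ c}, extendData ψ z ∂μ) / r| < ε / 3 := by
    rw [← sub_div, abs_div, abs_of_pos hr0, div_lt_iff₀ hr0, mul_comm]
    exact h4.trans_lt (hψ.trans_le (min_le_right _ _))
  have h6 := h3.trans_lt (hψ.trans_le (min_le_left _ _))
  rw [Real.dist_eq] at h2 ⊢
  rw [abs_lt] at *
  constructor <;> linarith [h2.1, h2.2, h5.1, h5.2, h6.1, h6.2]

end Pruned

/-! ### Weighted losses and their minimal values -/

/-- The loss, extended to the plane by projecting both arguments to `[0, 1]`. -/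
def clampLoss (ℓ : ℝ → ℝ → ℝ) (y y' : ℝ) : ℝ :=
  ℓ (projIcc (0 : ℝ) 1 zero_le_one y) (projIcc (0 : ℝ) 1 zero_le_one y')

lemma clampLoss_of_mem (ℓ : ℝ → ℝ → ℝ) {y y' : ℝ} (hy : y ∈ Icc (0 : ℝ) 1)
    (hy' : y' ∈ Icc (0 : ℝ) 1) : clampLoss ℓ y y' = ℓ y y' := by
  rw [clampLoss, projIcc_of_mem _ hy, projIcc_of_mem _ hy']

/-- The loss of the prediction `y` for labels `0` and `1` with weights `a.1` and `a.2`. -/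
def weightedLoss (ℓ : ℝ → ℝ → ℝ) (a : ℝ × ℝ) (y : ℝ) : ℝ :=
  a.1 * clampLoss ℓ y 0 + a.2 * clampLoss ℓ y 1

/-- The minimal value of the weighted loss over all predictions in `[0, 1]`. -/
def minLoss (ℓ : ℝ → ℝ → ℝ) (a : ℝ × ℝ) : ℝ := sInf (weightedLoss ℓ a '' Icc 0 1)

section Loss

variable {ℓ : ℝ → ℝ → ℝ}

lemma IsClassificationLoss.continuous_clampLoss (hℓ : IsClassificationLoss ℓ) :
    Continuous fun q : ℝ × ℝ => clampLoss ℓ q.1 q.2 := by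
  have h : Continuous fun q : ℝ × ℝ => (((projIcc (0 : ℝ) 1 zero_le_one q.1 : ℝ),
      (projIcc (0 : ℝ) 1 zero_le_one q.2 : ℝ)) : ℝ × ℝ) := by
    have := continuous_projIcc (h := zero_le_one (α := ℝ))
    fun_prop
  exact hℓ.continuousOn.comp_continuous h fun q => ⟨Subtype.coe_prop _, Subtype.coe_prop _⟩

lemma IsClassificationLoss.exists_bound (hℓ : IsClassificationLoss ℓ) :
    ∃ C, 0 ≤ C ∧ ∀ y y', |clampLoss ℓ y y'| ≤ C := by
  obtain ⟨C, hC⟩ := ((isCompact_Icc (a := (0 : ℝ)) (b := 1)).prod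
    isCompact_Icc).exists_bound_of_continuousOn hℓ.continuousOn
  have h : ∀ y y', |clampLoss ℓ y y'| ≤ C := fun y y' =>
    hC (projIcc (0 : ℝ) 1 zero_le_one y, projIcc (0 : ℝ) 1 zero_le_one y')
      ⟨Subtype.coe_prop _, Subtype.coe_prop _⟩
  exact ⟨C, (abs_nonneg _).trans (h 0 0), h⟩

lemma IsClassificationLoss.continuous_weightedLoss (hℓ : IsClassificationLoss ℓ) :
    Continuous fun q : (ℝ × ℝ) × ℝ => weightedLoss ℓ q.1 q.2 := by
  have h0 : Continuous fun q : (ℝ × ℝ) × ℝ => clampLoss ℓ q.2 0 :=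
    hℓ.continuous_clampLoss.comp (continuous_snd.prodMk continuous_const)
  have h1 : Continuous fun q : (ℝ × ℝ) × ℝ => clampLoss ℓ q.2 1 :=
    hℓ.continuous_clampLoss.comp (continuous_snd.prodMk continuous_const)
  unfold weightedLoss
  fun_prop

lemma IsClassificationLoss.continuous_minLoss (hℓ : IsClassificationLoss ℓ) :
    Continuous (minLoss ℓ) :=
  isCompact_Icc.continuous_sInf hℓ.continuous_weightedLoss

lemma IsClassificationLoss.exists_minLoss_eq (hℓ : IsClassificationLoss ℓ) (a : ℝ × ℝ) :
    ∃ y ∈ Icc (0 : ℝ) 1, minLoss ℓ a = weightedLoss ℓ a y := by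
  have hc : Continuous (weightedLoss ℓ a) :=
    hℓ.continuous_weightedLoss.comp (Continuous.prodMk_right a)
  obtain ⟨y, hy, h, -⟩ := isCompact_Icc.exists_sInf_image_eq_and_le (nonempty_Icc.2 zero_le_one)
    hc.continuousOn
  exact ⟨y, hy, h⟩

lemma IsClassificationLoss.minLoss_le (hℓ : IsClassificationLoss ℓ) (a : ℝ × ℝ) (y : ℝ) :
    minLoss ℓ a ≤ weightedLoss ℓ a y := by
  have hc : Continuous (weightedLoss ℓ a) :=
    hℓ.continuous_weightedLoss.comp (Continuous.prodMk_right a)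
  refine csInf_le (isCompact_Icc.image hc).bddBelow
    ⟨projIcc (0 : ℝ) 1 zero_le_one y, Subtype.coe_prop _, ?_⟩
  simp only [weightedLoss, clampLoss, projIcc_val]

lemma weightedLoss_add (a b : ℝ × ℝ) (y : ℝ) :
    weightedLoss ℓ (a + b) y = weightedLoss ℓ a y + weightedLoss ℓ b y := by
  simp only [weightedLoss, Prod.fst_add, Prod.snd_add]
  ring

lemma IsClassificationLoss.minLoss_add_le (hℓ : IsClassificationLoss ℓ) (a b : ℝ × ℝ) :
    minLoss ℓ a + minLoss ℓ b ≤ minLoss ℓ (a + b) := by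
  obtain ⟨y, -, h⟩ := hℓ.exists_minLoss_eq (a + b)
  rw [h, weightedLoss_add]
  exact add_le_add (hℓ.minLoss_le a y) (hℓ.minLoss_le b y)

lemma abs_weightedLoss_le {C B : ℝ} (hC : ∀ y y', |clampLoss ℓ y y'| ≤ C) {a : ℝ × ℝ}
    (ha : ‖a‖ ≤ B) (y : ℝ) : |weightedLoss ℓ a y| ≤ 2 * (B * C) := by
  have hB : 0 ≤ B := (norm_nonneg _).trans ha
  have h0 : |a.1 * clampLoss ℓ y 0| ≤ B * C := by
    rw [abs_mul]
    exact mul_le_mul ((norm_fst_le a).trans ha) (hC y 0) (abs_nonneg _) hB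
  have h1 : |a.2 * clampLoss ℓ y 1| ≤ B * C := by
    rw [abs_mul]
    exact mul_le_mul ((norm_snd_le a).trans ha) (hC y 1) (abs_nonneg _) hB
  rw [weightedLoss, two_mul]
  exact (abs_add_le _ _).trans (add_le_add h0 h1)

variable {d : ℕ} {ν : Measure (Input d)} [IsFiniteMeasure ν] {a : Input d → ℝ × ℝ}

lemma IsClassificationLoss.integrable_weightedLoss (hℓ : IsClassificationLoss ℓ)
    (ha : Measurable a) {B : ℝ} (hB : ∀ x, ‖a x‖ ≤ B) {f : Input d → ℝ} (hf : Measurable f) :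
    Integrable (fun x => weightedLoss ℓ (a x) (f x)) ν := by
  obtain ⟨C, -, hC⟩ := hℓ.exists_bound
  exact Integrable.of_bound
    (hℓ.continuous_weightedLoss.measurable.comp (ha.prodMk hf)).aestronglyMeasurable
    (2 * (B * C)) (Eventually.of_forall fun x => abs_weightedLoss_le hC (hB x) _)

lemma IsClassificationLoss.integrable_minLoss (hℓ : IsClassificationLoss ℓ)
    (ha : Measurable a) {B : ℝ} (hB : ∀ x, ‖a x‖ ≤ B) :
    Integrable (fun x => minLoss ℓ (a x)) ν := by
  obtain ⟨C, -, hC⟩ := hℓ.exists_bound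
  refine Integrable.of_bound (hℓ.continuous_minLoss.measurable.comp ha).aestronglyMeasurable
    (2 * (B * C)) (Eventually.of_forall fun x => ?_)
  obtain ⟨y, -, hy⟩ := hℓ.exists_minLoss_eq (a x)
  rw [hy]
  exact abs_weightedLoss_le hC (hB x) _

/-- A measurable choice of nearly optimal predictions. -/
lemma IsClassificationLoss.exists_measurable_weightedLoss_le (hℓ : IsClassificationLoss ℓ)
    (ha : Measurable a) {ε : ℝ} (hε : 0 < ε) :
    ∃ f : Input d → ℝ, Measurable f ∧ (∀ x, f x ∈ Icc (0 : ℝ) 1) ∧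
      ∀ x, weightedLoss ℓ (a x) (f x) ≤ minLoss ℓ (a x) + ε := by
  classical
  have : Nonempty (Icc (0 : ℝ) 1) := ⟨⟨0, by simp⟩⟩
  let y : ℕ → Icc (0 : ℝ) 1 := TopologicalSpace.denseSeq _
  have hex : ∀ x, ∃ n, weightedLoss ℓ (a x) (y n) < minLoss ℓ (a x) + ε := fun x => by
    obtain ⟨y₀, hy₀, h₀⟩ := hℓ.exists_minLoss_eq (a x)
    have hc : Continuous fun t : Icc (0 : ℝ) 1 => weightedLoss ℓ (a x) t :=
      hℓ.continuous_weightedLoss.comp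
        ((Continuous.prodMk_right (a x)).comp continuous_subtype_val)
    obtain ⟨t, ht, n, rfl⟩ :=
      (TopologicalSpace.denseRange_denseSeq (Icc (0 : ℝ) 1)).inter_open_nonempty
      _ (isOpen_Iio.preimage hc) ⟨⟨y₀, hy₀⟩, show _ < minLoss ℓ (a x) + ε by rw [h₀]; linarith⟩
    exact ⟨n, ht⟩
  have hm : ∀ n, MeasurableSet {x | weightedLoss ℓ (a x) (y n) < minLoss ℓ (a x) + ε} := fun n =>
    measurableSet_lt (hℓ.continuous_weightedLoss.measurable.comp (ha.prodMk measurable_const))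
      ((hℓ.continuous_minLoss.measurable.comp ha).add_const ε)
  exact ⟨fun x => y (Nat.find (hex x)),
    (measurable_from_nat (f := fun n => (y n : ℝ))).comp (measurable_find hex hm),
    fun x => (y _).2, fun x => (Nat.find_spec (hex x)).le⟩

/-- A measurable function with values in `[0, 1]` is an almost everywhere limit of continuous
functions with values in `[0, 1]`. -/
lemma exists_continuous_tendsto_ae {f₀ : Input d → ℝ} (hf₀m : Measurable f₀)
    (hf₀ : ∀ x, f₀ x ∈ Icc (0 : ℝ) 1) :
    ∃ F : ℕ → Input d → ℝ, (∀ n, Continuous (F n)) ∧ (∀ n x, F n x ∈ Icc (0 : ℝ) 1) ∧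
      ∀ᵐ x ∂ν, Tendsto (fun n => F n x) atTop (𝓝 (f₀ x)) := by
  have hint : MemLp f₀ 1 ν := memLp_one_iff_integrable.2 <|
    Integrable.of_bound hf₀m.aestronglyMeasurable 1
    (Eventually.of_forall fun x => by
      rw [Real.norm_eq_abs, abs_of_nonneg (hf₀ x).1]; exact (hf₀ x).2)
  have hex : ∀ n : ℕ, ∃ h : Input d → ℝ, Continuous h ∧
      eLpNorm (f₀ - h) 1 ν ≤ ENNReal.ofReal (1 / ((n : ℝ) + 1)) := fun n => by
    obtain ⟨h, hh, -⟩ := hint.exists_boundedContinuous_eLpNorm_sub_le (by simp)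
      (ε := ENNReal.ofReal (1 / ((n : ℝ) + 1)))
      (by simpa only [ne_eq, ENNReal.ofReal_eq_zero, not_le] using Nat.one_div_pos_of_nat)
    exact ⟨h, h.continuous, hh⟩
  choose h hc hh using hex
  have hmeas : TendstoInMeasure ν h atTop f₀ := by
    refine tendstoInMeasure_of_tendsto_eLpNorm one_ne_zero
      (fun n => (hc n).aestronglyMeasurable) hf₀m.aestronglyMeasurable ?_
    have hz : Tendsto (fun n : ℕ => ENNReal.ofReal (1 / ((n : ℝ) + 1))) atTop (𝓝 0) := by
      simpa using ENNReal.tendsto_ofReal tendsto_one_div_add_atTop_nhds_zero_nat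
    refine tendsto_of_tendsto_of_tendsto_of_le_of_le tendsto_const_nhds hz (fun _ => zero_le)
      fun n => ?_
    rw [eLpNorm_sub_comm]
    exact hh n
  obtain ⟨ns, -, hns⟩ := hmeas.exists_seq_tendsto_ae
  have hproj : Continuous fun t : ℝ => (projIcc (0 : ℝ) 1 zero_le_one t : ℝ) :=
    continuous_subtype_val.comp continuous_projIcc
  refine ⟨fun n x => projIcc (0 : ℝ) 1 zero_le_one (h (ns n) x), fun n => hproj.comp (hc (ns n)),
    fun n x => Subtype.coe_prop _, ?_⟩
  filter_upwards [hns] with x hx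
  have h2 := (hproj.tendsto (f₀ x)).comp hx
  simpa only [Function.comp_def, projIcc_of_mem _ (hf₀ x)] using h2

/-- Continuous functions with values in `[0, 1]` come close to the integral of the minimal weighted
loss. -/
lemma IsClassificationLoss.exists_continuous_integral_lt (hℓ : IsClassificationLoss ℓ)
    (ha : Measurable a) {B : ℝ} (hB : ∀ x, ‖a x‖ ≤ B) {t : ℝ}
    (ht : ∫ x, minLoss ℓ (a x) ∂ν < t) :
    ∃ f : Input d → ℝ, Continuous f ∧ (∀ x, f x ∈ Icc (0 : ℝ) 1) ∧
      ∫ x, weightedLoss ℓ (a x) (f x) ∂ν < t := by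
  set ε : ℝ := t - ∫ x, minLoss ℓ (a x) ∂ν with hε
  have hε0 : 0 < ε := sub_pos.2 ht
  have hν : 0 ≤ ν.real univ := measureReal_nonneg
  obtain ⟨f₀, hf₀m, hf₀, hf₀le⟩ := hℓ.exists_measurable_weightedLoss_le ha
    (show 0 < ε / 2 / (ν.real univ + 1) by positivity)
  have hlt : ∫ x, weightedLoss ℓ (a x) (f₀ x) ∂ν < t := by
    have h1 := integral_mono (hℓ.integrable_weightedLoss (ν := ν) ha hB hf₀m)
        ((hℓ.integrable_minLoss ha hB).add (integrable_const _)) hf₀le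
    simp only [Pi.add_apply] at h1
    rw [integral_add (hℓ.integrable_minLoss ha hB) (integrable_const _), integral_const,
      smul_eq_mul] at h1
    have h2 : ν.real univ * (ε / 2 / (ν.real univ + 1)) ≤ ε / 2 := by
      rw [← mul_div_assoc, div_le_iff₀ (by positivity)]
      nlinarith
    linarith
  obtain ⟨F, hFc, hF01, hF⟩ := exists_continuous_tendsto_ae (ν := ν) hf₀m hf₀
  obtain ⟨C, -, hC⟩ := hℓ.exists_bound
  have hlim : Tendsto (fun n => ∫ x, weightedLoss ℓ (a x) (F n x) ∂ν) atTop
      (𝓝 (∫ x, weightedLoss ℓ (a x) (f₀ x) ∂ν)) := by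
    refine tendsto_integral_of_dominated_convergence (fun _ => 2 * (B * C))
      (fun n => (hℓ.integrable_weightedLoss ha hB (hFc n).measurable).aestronglyMeasurable)
      (integrable_const _) (fun n => Eventually.of_forall fun x =>
        abs_weightedLoss_le hC (hB x) _) ?_
    filter_upwards [hF] with x hx
    exact (hℓ.continuous_weightedLoss.tendsto (a x, f₀ x)).comp (tendsto_const_nhds.prodMk_nhds hx)
  obtain ⟨n, hn⟩ := (hlim.eventually_lt_const hlt).exists
  exact ⟨F n, hFc n, hF01 n, hn⟩

end Loss

/-! ### Disintegration of the data distribution -/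

section Disintegration

variable {d : ℕ} {X : Set (Input d)} {μ : Measure (Sample d)} {p : Input d → ℝ}

lemma IsBinaryProcess.measurable_indicator (hX : IsCompact X) (hμ : IsBinaryProcess X μ p) :
    Measurable (X.indicator p) := by
  have hXm := hX.isClosed.measurableSet
  refine measurable_of_Iio fun c => ?_
  obtain ⟨U, hU, hUe⟩ := upperSemicontinuousOn_iff_preimage_Iio.1 hμ.usc c
  have : X.indicator p ⁻¹' Iio c = X ∩ U ∪ Xᶜ ∩ {_x | 0 < c} := by
    rw [← hUe]
    ext x
    by_cases hx : x ∈ X <;> simp [hx]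
  rw [this]
  exact (hXm.inter hU.measurableSet).union (hXm.compl.inter (MeasurableSet.const _))

lemma IsBinaryProcess.indicator_mem_Icc (hμ : IsBinaryProcess X μ p) (x : Input d) :
    X.indicator p x ∈ Icc (0 : ℝ) 1 := by
  by_cases hx : x ∈ X
  · rw [indicator_of_mem hx]; exact hμ.mem_Icc x hx
  · rw [indicator_of_notMem hx]; simp

/-- The inputs with label `1` have density `p` with respect to the input distribution. -/
lemma IsBinaryProcess.map_restrict_eq_withDensity [IsProbabilityMeasure μ] (hX : IsCompact X)
    (hμ : IsBinaryProcess X μ p) :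
    (μ.restrict {z | z.2 = 1}).map Prod.fst =
      (μ.map Prod.fst).withDensity fun x => ENNReal.ofReal (X.indicator p x) := by
  have hp := hμ.measurable_indicator hX
  have hprob : IsProbabilityMeasure (μ.map Prod.fst) :=
    Measure.isProbabilityMeasure_map measurable_fst.aemeasurable
  have hXae : ∀ᵐ x ∂(μ.map Prod.fst), x ∈ X := by
    refine (ae_map_iff (p := (· ∈ X)) measurable_fst.aemeasurable hX.isClosed.measurableSet).2 ?_
    filter_upwards [hμ.ae_mem] with z hz using hz.1
  ext B hB
  rw [Measure.map_apply measurable_fst hB, Measure.restrict_apply (measurable_fst hB),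
    withDensity_apply _ hB, ← ofReal_integral_eq_lintegral_ofReal]
  · have h1 : Prod.fst ⁻¹' B ∩ {z : Sample d | z.2 = 1} = B ×ˢ ({1} : Set ℝ) := by
      ext z; simp
    have h2 : ∫ x in B, X.indicator p x ∂(μ.map Prod.fst) = ∫ x in B, p x ∂(μ.map Prod.fst) := by
      refine integral_congr_ae (ae_restrict_of_ae ?_)
      filter_upwards [hXae] with x hx using indicator_of_mem hx p
    rw [h1, h2, ← hμ.condProb B hB, ofReal_measureReal]
  · refine (Integrable.of_bound hp.aestronglyMeasurable 1
      (Eventually.of_forall fun x => ?_)).restrict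
    rw [Real.norm_eq_abs, abs_of_nonneg (hμ.indicator_mem_Icc x).1]
    exact (hμ.indicator_mem_Icc x).2
  · exact Eventually.of_forall fun x => (hμ.indicator_mem_Icc x).1

/-- Integration over the two labels given the input, then over the inputs. -/
lemma IsBinaryProcess.integral_eq [IsProbabilityMeasure μ] (hX : IsCompact X)
    (hμ : IsBinaryProcess X μ p)
    {Φ : Sample d → ℝ} (hΦ : Measurable Φ) {C : ℝ} (hC : ∀ z, |Φ z| ≤ C) :
    ∫ z, Φ z ∂μ = ∫ x, ((1 - X.indicator p x) * Φ (x, 0) + X.indicator p x * Φ (x, 1))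
      ∂(μ.map Prod.fst) := by
  have hp := hμ.measurable_indicator hX
  have hprob : IsProbabilityMeasure (μ.map Prod.fst) :=
    Measure.isProbabilityMeasure_map measurable_fst.aemeasurable
  set S : Set (Sample d) := {z | z.2 = 1} with hS
  have hSm : MeasurableSet S := measurable_snd (measurableSet_singleton 1)
  have hΦ' : ∀ y : ℝ, Measurable fun x : Input d => Φ (x, y) := fun y =>
    hΦ.comp (measurable_id.prodMk measurable_const)
  have hint : ∀ (ν : Measure (Input d)) [IsFiniteMeasure ν] (y : ℝ),
      Integrable (fun x => Φ (x, y)) ν := fun ν _ y =>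
    Integrable.of_bound (hΦ' y).aestronglyMeasurable C (Eventually.of_forall fun x => hC _)
  have h1 : ∫ z in S, Φ z ∂μ = ∫ x, Φ (x, 1) ∂((μ.restrict S).map Prod.fst) := by
    rw [integral_map measurable_fst.aemeasurable (hΦ' 1).aestronglyMeasurable]
    refine setIntegral_congr_fun hSm fun z hz => ?_
    simp only [← show z.2 = 1 from hz]
  have h0 : ∫ z in Sᶜ, Φ z ∂μ = ∫ x, Φ (x, 0) ∂((μ.restrict Sᶜ).map Prod.fst) := by
    rw [integral_map measurable_fst.aemeasurable (hΦ' 0).aestronglyMeasurable]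
    refine setIntegral_congr_ae hSm.compl ?_
    filter_upwards [hμ.ae_mem] with z hz hzS
    rcases hz.2 with h | h
    · simp only [← h]
    · exact absurd h hzS
  have hadd : (μ.restrict S).map Prod.fst + (μ.restrict Sᶜ).map Prod.fst = μ.map Prod.fst := by
    rw [← Measure.map_add _ _ measurable_fst, Measure.restrict_add_restrict_compl hSm]
  have h2 : ∫ x, Φ (x, 0) ∂((μ.restrict Sᶜ).map Prod.fst) = ∫ x, Φ (x, 0) ∂(μ.map Prod.fst) -
      ∫ x, Φ (x, 0) ∂((μ.restrict S).map Prod.fst) := by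
    rw [← hadd, integral_add_measure (hint _ 0) (hint _ 0)]
    ring
  have hdens : ∀ y : ℝ, ∫ x, Φ (x, y) ∂((μ.restrict S).map Prod.fst) =
      ∫ x, X.indicator p x * Φ (x, y) ∂(μ.map Prod.fst) := fun y => by
    rw [hμ.map_restrict_eq_withDensity hX, integral_withDensity_eq_integral_toReal_smul
      hp.ennreal_ofReal (Eventually.of_forall fun x => ENNReal.ofReal_lt_top)]
    simp only [ENNReal.toReal_ofReal (hμ.indicator_mem_Icc _).1, smul_eq_mul]
  have hintp : ∀ y : ℝ, Integrable (fun x => X.indicator p x * Φ (x, y)) (μ.map Prod.fst) :=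
    fun y => (hint _ y).bdd_mul hp.aestronglyMeasurable (c := 1) (Eventually.of_forall fun x => by
      rw [Real.norm_eq_abs, abs_of_nonneg (hμ.indicator_mem_Icc x).1]
      exact (hμ.indicator_mem_Icc x).2)
  have hiΦ : Integrable Φ μ := Integrable.of_bound hΦ.aestronglyMeasurable C
    (Eventually.of_forall fun x => hC _)
  rw [← integral_add_compl hSm hiΦ, h1, h0, h2, hdens, hdens,
    ← integral_sub (hint _ 0) (hintp 0), ← integral_add (hintp 1)
      (g := fun x => Φ (x, 0) - X.indicator p x * Φ (x, 0)) ((hint _ 0).sub (hintp 0))]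
  refine integral_congr_ae (Eventually.of_forall fun x => ?_)
  simp only
  ring

/-- The densities, with respect to the input distribution, of the samples in `Q` with labels `0`
and `1`. -/
def labelWeights (X : Set (Input d)) (p : Input d → ℝ) (Q : Set (Sample d)) (x : Input d) : ℝ × ℝ :=
  ((1 - X.indicator p x) * Q.indicator 1 (x, (0 : ℝ)),
    X.indicator p x * Q.indicator 1 (x, (1 : ℝ)))

lemma IsBinaryProcess.measurable_labelWeights (hX : IsCompact X) (hμ : IsBinaryProcess X μ p)
    {Q : Set (Sample d)} (hQ : MeasurableSet Q) : Measurable (labelWeights X p Q) := by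
  have hp := hμ.measurable_indicator hX
  have h : ∀ y : ℝ, Measurable fun x : Input d => Q.indicator (1 : Sample d → ℝ) (x, y) := fun y =>
    (measurable_one.indicator hQ).comp (measurable_id.prodMk measurable_const)
  exact ((measurable_const.sub hp).mul (h 0)).prodMk (hp.mul (h 1))

lemma IsBinaryProcess.norm_labelWeights_le (hμ : IsBinaryProcess X μ p) (Q : Set (Sample d))
    (x : Input d) : ‖labelWeights X p Q x‖ ≤ 1 := by
  have hp := hμ.indicator_mem_Icc x
  have h : ∀ y : ℝ, |Q.indicator (1 : Sample d → ℝ) (x, y)| ≤ 1 := fun y => by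
    by_cases hy : (x, y) ∈ Q <;> simp [hy]
  refine norm_prod_le_iff.2 ⟨?_, ?_⟩
  · rw [labelWeights, Real.norm_eq_abs, abs_mul]
    exact mul_le_one₀ (by rw [abs_of_nonneg (by linarith [hp.2])]; linarith [hp.1])
      (abs_nonneg _) (h 0)
  · rw [labelWeights, Real.norm_eq_abs, abs_mul]
    exact mul_le_one₀ (by rw [abs_of_nonneg hp.1]; exact hp.2) (abs_nonneg _) (h 1)

lemma IsBinaryProcess.setIntegral_loss_eq [IsProbabilityMeasure μ] (hX : IsCompact X)
    (hμ : IsBinaryProcess X μ p)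
    {ℓ : ℝ → ℝ → ℝ} (hℓ : IsClassificationLoss ℓ) {Q : Set (Sample d)} (hQ : MeasurableSet Q)
    {f : Input d → ℝ} (hf : Measurable f) :
    ∫ z in Q, clampLoss ℓ (f z.1) z.2 ∂μ =
      ∫ x, weightedLoss ℓ (labelWeights X p Q x) (f x) ∂(μ.map Prod.fst) := by
  obtain ⟨C, hC0, hC⟩ := hℓ.exists_bound
  have hm : Measurable fun z : Sample d => clampLoss ℓ (f z.1) z.2 :=
    hℓ.continuous_clampLoss.measurable.comp ((hf.comp measurable_fst).prodMk measurable_snd)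
  rw [← integral_indicator hQ, hμ.integral_eq hX (hm.indicator hQ) (C := C) fun z => ?_]
  · refine integral_congr_ae (Eventually.of_forall fun x => ?_)
    by_cases h0 : (x, (0 : ℝ)) ∈ Q <;> by_cases h1 : (x, (1 : ℝ)) ∈ Q <;>
      simp [weightedLoss, labelWeights, h0, h1]
  · by_cases hz : z ∈ Q <;> simp [hz, hC, hC0]

end Disintegration

/-! ### Pruning changes the optimal predictions -/

lemma integral_lt_integral_of_le_of_lt {α : Type*} [MeasurableSpace α] {ν : Measure α}
    {f h : α → ℝ} (hf : Integrable f ν) (hh : Integrable h ν) (hle : ∀ x, f x ≤ h x) {T : Set α}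
    (hT : ν T ≠ 0) (hlt : ∀ x ∈ T, f x < h x) : ∫ x, f x ∂ν < ∫ x, h x ∂ν := by
  rw [← sub_pos, ← integral_sub hh hf]
  refine (integral_pos_iff_support_of_nonneg (fun x => sub_nonneg.2 (hle x)) (hh.sub hf)).2 ?_
  refine (pos_iff_ne_zero.2 hT).trans_le (measure_mono fun x hx => ?_)
  exact (sub_pos.2 (hlt x hx)).ne'

section Loss

variable {ℓ : ℝ → ℝ → ℝ}

lemma IsClassificationLoss.clampLoss_nonneg (hℓ : IsClassificationLoss ℓ) (y y' : ℝ) :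
    0 ≤ clampLoss ℓ y y' :=
  hℓ.nonneg _ (Subtype.coe_prop _) _ (Subtype.coe_prop _)

lemma IsClassificationLoss.clampLoss_eq_zero_iff (hℓ : IsClassificationLoss ℓ) {y y' : ℝ}
    (hy : y ∈ Icc (0 : ℝ) 1) (hy' : y' ∈ Icc (0 : ℝ) 1) : clampLoss ℓ y y' = 0 ↔ y = y' := by
  rw [clampLoss_of_mem ℓ hy hy', hℓ.eq_zero_iff y hy y' hy']

lemma weightedLoss_bernoulli {q y : ℝ} (hy : y ∈ Icc (0 : ℝ) 1) :
    weightedLoss ℓ (1 - q, q) y = q * ℓ y 1 + (1 - q) * ℓ y 0 := by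
  rw [weightedLoss, clampLoss_of_mem ℓ hy (by simp), clampLoss_of_mem ℓ hy (by simp)]
  ring

/-- For label probabilities in `(0, 1)` the optimal prediction is not a label. -/
lemma IsClassificationLoss.minLoss_lt_weightedLoss_label (hℓ : IsClassificationLoss ℓ) {q : ℝ}
    (hq : q ∈ Ioo (0 : ℝ) 1) {y : ℝ} (hy : y = 0 ∨ y = 1) :
    minLoss ℓ (1 - q, q) < weightedLoss ℓ (1 - q, q) y := by
  obtain ⟨ystar, hmono, hmin⟩ := hℓ.exists_minimizer
  have h01 : (0 : ℝ) ∈ Icc (0 : ℝ) 1 := by simp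
  have h11 : (1 : ℝ) ∈ Icc (0 : ℝ) 1 := by simp
  have hqI : q ∈ Icc (0 : ℝ) 1 := ⟨hq.1.le, hq.2.le⟩
  have h0 : ystar 0 = 0 := by
    by_contra h
    have h1 := (hmin 0 h01).2 0 h01 (Ne.symm h)
    rw [(hℓ.eq_zero_iff 0 h01 0 h01).2 rfl] at h1
    have h2 := hℓ.nonneg _ (hmin 0 h01).1 0 h01
    simp only [zero_mul, zero_add, sub_zero, one_mul] at h1
    linarith
  have h1 : ystar 1 = 1 := by
    by_contra h
    have h1 := (hmin 1 h11).2 1 h11 (Ne.symm h)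
    rw [(hℓ.eq_zero_iff 1 h11 1 h11).2 rfl] at h1
    have h2 := hℓ.nonneg _ (hmin 1 h11).1 1 h11
    simp only [zero_mul, sub_self, add_zero, one_mul] at h1
    linarith
  have hyI : y ∈ Icc (0 : ℝ) 1 := by rcases hy with rfl | rfl <;> simp
  have hne : y ≠ ystar q := by
    have h2 := hmono h01 hqI hq.1
    have h3 := hmono hqI h11 hq.2
    rw [h0] at h2
    rw [h1] at h3
    rcases hy with rfl | rfl
    · exact h2.ne
    · exact h3.ne'
  refine (hℓ.minLoss_le _ (ystar q)).trans_lt ?_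
  rw [weightedLoss_bernoulli hyI, weightedLoss_bernoulli (hmin q hqI).1]
  exact (hmin q hqI).2 y hyI hne

/-- No prediction is optimal both for a nondegenerate label and for a deterministic one. -/
lemma IsClassificationLoss.minLoss_add_lt (hℓ : IsClassificationLoss ℓ) {q : ℝ}
    (hq : q ∈ Ioo (0 : ℝ) 1) {b : ℝ × ℝ} (hb : b = (1 - q, 0) ∨ b = (0, q)) :
    minLoss ℓ (1 - q, q) + minLoss ℓ b < minLoss ℓ ((1 - q, q) + b) := by
  obtain ⟨y, hy, h⟩ := hℓ.exists_minLoss_eq ((1 - q, q) + b)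
  rw [h, weightedLoss_add]
  have ha := hℓ.minLoss_le (1 - q, q) y
  have hb' := hℓ.minLoss_le b y
  have h01 : (0 : ℝ) ∈ Icc (0 : ℝ) 1 := by simp
  have h11 : (1 : ℝ) ∈ Icc (0 : ℝ) 1 := by simp
  by_contra! hcon
  have hay : weightedLoss ℓ (1 - q, q) y ≤ minLoss ℓ (1 - q, q) := by linarith
  have hby : weightedLoss ℓ b y ≤ minLoss ℓ b := by linarith
  rcases hb with rfl | rfl
  · have h0 := hby.trans (hℓ.minLoss_le _ 0)
    simp only [weightedLoss, (hℓ.clampLoss_eq_zero_iff h01 h01).2 rfl, mul_zero, zero_mul,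
      add_zero] at h0
    have h1 : clampLoss ℓ y 0 = 0 := by
      nlinarith [hℓ.clampLoss_nonneg y 0, sub_pos.2 hq.2]
    obtain rfl := (hℓ.clampLoss_eq_zero_iff hy h01).1 h1
    exact absurd hay (hℓ.minLoss_lt_weightedLoss_label hq (Or.inl rfl)).not_ge
  · have h0 := hby.trans (hℓ.minLoss_le _ 1)
    simp only [weightedLoss, (hℓ.clampLoss_eq_zero_iff h11 h11).2 rfl, mul_zero, zero_mul,
      zero_add] at h0
    have h1 : clampLoss ℓ y 1 = 0 := by
      nlinarith [hℓ.clampLoss_nonneg y 1, hq.1]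
    obtain rfl := (hℓ.clampLoss_eq_zero_iff hy h11).1 h1
    exact absurd hay (hℓ.minLoss_lt_weightedLoss_label hq (Or.inr rfl)).not_ge

/-- The weighted loss is not constant in the prediction, unless the weights vanish. -/
lemma IsClassificationLoss.minLoss_add_minLoss_neg_lt (hℓ : IsClassificationLoss ℓ) {u : ℝ × ℝ}
    (hu : u ≠ 0) : minLoss ℓ u + minLoss ℓ (-u) < 0 := by
  have h01 : (0 : ℝ) ∈ Icc (0 : ℝ) 1 := by simp
  have h11 : (1 : ℝ) ∈ Icc (0 : ℝ) 1 := by simp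
  have hneg : ∀ y, weightedLoss ℓ (-u) y = -weightedLoss ℓ u y := fun y => by
    simp only [weightedLoss, Prod.fst_neg, Prod.snd_neg]; ring
  by_contra! hcon
  have hconst : ∀ y y', weightedLoss ℓ u y ≤ weightedLoss ℓ u y' := fun y y' => by
    have h1 := hℓ.minLoss_le u y'
    have h2 := hℓ.minLoss_le (-u) y
    rw [hneg] at h2
    linarith
  have hc0 : 0 < clampLoss ℓ 1 0 := lt_of_le_of_ne (hℓ.clampLoss_nonneg 1 0) fun h =>
    one_ne_zero ((hℓ.clampLoss_eq_zero_iff h11 h01).1 h.symm)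
  have hc1 : 0 < clampLoss ℓ 0 1 := lt_of_le_of_ne (hℓ.clampLoss_nonneg 0 1) fun h =>
    zero_ne_one ((hℓ.clampLoss_eq_zero_iff h01 h11).1 h.symm)
  -- comparing the predictions `0` and `1`, both weights have the same sign
  have heq : u.2 * clampLoss ℓ 0 1 = u.1 * clampLoss ℓ 1 0 := by
    have := le_antisymm (hconst 0 1) (hconst 1 0)
    simpa [weightedLoss, (hℓ.clampLoss_eq_zero_iff h01 h01).2 rfl,
      (hℓ.clampLoss_eq_zero_iff h11 h11).2 rfl] using this
  set s := u.1 + u.2 with hs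
  have hs0 : s ≠ 0 := by
    intro h
    have h1 : u.1 = -u.2 := by linarith
    rw [h1] at heq
    have h2 : u.2 = 0 := by nlinarith
    exact hu (Prod.ext (by rw [h1, h2]; simp) h2)
  set q := u.2 / s with hq
  have hq1 : 1 - q = u.1 / s := by rw [hq, eq_div_iff hs0, sub_mul, div_mul_cancel₀ _ hs0]; linarith
  have hscale : ∀ y, weightedLoss ℓ u y = s * weightedLoss ℓ (1 - q, q) y := fun y => by
    simp only [weightedLoss]
    rw [hq1, hq]
    field_simp
  have hq3 : q * clampLoss ℓ 0 1 = (1 - q) * clampLoss ℓ 1 0 := by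
    rw [hq1, hq, div_mul_eq_mul_div, heq, div_mul_eq_mul_div]
  have hqI : q ∈ Ioo (0 : ℝ) 1 := by
    constructor <;> by_contra! h <;> nlinarith
  obtain ⟨y, hy, h⟩ := hℓ.exists_minLoss_eq (1 - q, q)
  have hlt := hℓ.minLoss_lt_weightedLoss_label hqI (Or.inl rfl)
  rw [h] at hlt
  have h1 := hconst y 0
  have h2 := hconst 0 y
  rw [hscale, hscale] at h1 h2
  exact hlt.ne (mul_left_cancel₀ hs0 (le_antisymm h1 h2))

end Loss

section Threshold

variable {d : ℕ} {X : Set (Input d)} {μ : Measure (Sample d)} [IsProbabilityMeasure μ]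
  {p : Input d → ℝ} {g : Sample d → ℝ} {ℓ : ℝ → ℝ → ℝ}

lemma measureReal_mem_Ioo {Q : Set (Sample d)} (hQ : MeasurableSet Q) (h : μ Q ≠ 0)
    (h' : μ Qᶜ ≠ 0) : μ.real Q ∈ Ioo (0 : ℝ) 1 := by
  have h1 : 0 < μ.real Q := ENNReal.toReal_pos h (measure_ne_top _ _)
  have h2 : 0 < μ.real Qᶜ := ENNReal.toReal_pos h' (measure_ne_top _ _)
  rw [probReal_compl_eq_one_sub hQ] at h2
  exact ⟨h1, by linarith⟩

/-- The law of an adapted score has no atoms, hence its support contains two points. -/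
lemma IsAdapted.exists_threshold (hX : IsCompact X) (hμ : IsBinaryProcess X μ p)
    (hg : IsAdapted X g) :
    ∃ c, μ.real {z | (dataSpace X).indicator g z ≤ c} ∈ Ioo (0 : ℝ) 1 := by
  have hG := hg.measurable_indicator hX
  set G := (dataSpace X).indicator g with hGdef
  set ν := μ.map G with hν
  have : IsProbabilityMeasure ν := Measure.isProbabilityMeasure_map hG.aemeasurable
  have hatom : ∀ c, ν {c} = 0 := fun c => by
    rw [hν, Measure.map_apply hG (measurableSet_singleton c)]
    exact hg.measure_level_eq_zero hX hμ c
  obtain ⟨a, ha, b, hb, hab⟩ : ν.support.Nontrivial := by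
    by_contra h
    rcases (not_nontrivial_iff.1 h).eq_empty_or_singleton with h0 | ⟨a, h0⟩
    · exact IsProbabilityMeasure.ne_zero ν (Measure.support_eq_empty_iff.1 h0)
    · have h1 := Measure.measure_compl_support (μ := ν)
      rw [h0] at h1
      have h2 : ν univ = 0 := by
        rw [← union_compl_self {a}]
        exact measure_union_null (hatom a) h1
      simp at h2
  wlog hlt : a < b generalizing a b
  · exact this b hb a ha hab.symm (lt_of_le_of_ne (not_lt.1 hlt) hab.symm)
  obtain ⟨c, hac, hcb⟩ := exists_between hlt
  refine ⟨c, measureReal_mem_Ioo (measurableSet_le hG measurable_const) ?_ ?_⟩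
  · have h1 := (Measure.mem_support_iff_forall a).1 ha (Iic c) (Iic_mem_nhds hac)
    rw [hν, Measure.map_apply hG measurableSet_Iic] at h1
    exact h1.ne'
  · have h1 := (Measure.mem_support_iff_forall b).1 hb (Ioi c) (Ioi_mem_nhds hcb)
    rw [hν, Measure.map_apply hG measurableSet_Ioi] at h1
    convert h1.ne' using 2
    ext z
    simp

/-- Some continuous prediction has different risks before and after conditioning on `Q`: the
difference of the weights vanishes at no input. -/
lemma IsBinaryProcess.exists_continuous_setIntegral_ne (hX : IsCompact X)
    (hμ : IsBinaryProcess X μ p) (hℓ : IsClassificationLoss ℓ) {Q : Set (Sample d)}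
    (hQ : MeasurableSet Q) {r : ℝ} (hr : r ∈ Ioo (0 : ℝ) 1) :
    ∃ f : Input d → ℝ, Continuous f ∧ (∀ x, f x ∈ Icc (0 : ℝ) 1) ∧
      ∫ z in Q, clampLoss ℓ (f z.1) z.2 ∂μ ≠ r * ∫ z, clampLoss ℓ (f z.1) z.2 ∂μ := by
  have hprob : IsProbabilityMeasure (μ.map Prod.fst) :=
    Measure.isProbabilityMeasure_map measurable_fst.aemeasurable
  let u : Input d → ℝ × ℝ := fun x => labelWeights X p Q x - r • labelWeights X p univ x
  have hmQ := hμ.measurable_labelWeights hX hQ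
  have hmU := hμ.measurable_labelWeights hX MeasurableSet.univ
  have hum : Measurable u := hmQ.sub (hmU.const_smul r)
  have huB : ∀ x, ‖u x‖ ≤ 2 := fun x => by
    have h1 := hμ.norm_labelWeights_le Q x
    have h2 : ‖r • labelWeights X p univ x‖ ≤ 1 := by
      rw [norm_smul, Real.norm_eq_abs, abs_of_pos hr.1]
      exact mul_le_one₀ hr.2.le (norm_nonneg _) (hμ.norm_labelWeights_le univ x)
    linarith [norm_sub_le (labelWeights X p Q x) (r • labelWeights X p univ x)]
  have hnum : Measurable fun x => -u x := hum.neg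
  have hnuB : ∀ x, ‖-u x‖ ≤ 2 := fun x => by rw [norm_neg]; exact huB x
  have hne : ∀ x, u x ≠ 0 := fun x h => by
    have h1 := congrArg Prod.fst h
    have h2 := congrArg Prod.snd h
    simp only [u, labelWeights, Prod.fst_sub, Prod.smul_fst, Prod.snd_sub, Prod.smul_snd,
      indicator_univ, Pi.one_apply, mul_one, smul_eq_mul, Prod.fst_zero, Prod.snd_zero] at h1 h2
    have key : ∀ (t : ℝ) (z : Sample d), t * Q.indicator 1 z - r * t = 0 → t = 0 := fun t z ht => by
      by_cases hz : z ∈ Q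
      · rw [indicator_of_mem hz, Pi.one_apply] at ht
        nlinarith [sub_pos.2 hr.2]
      · rw [indicator_of_notMem hz] at ht
        nlinarith [hr.1]
    have h3 := key _ _ h1
    have h4 := key _ _ h2
    linarith
  have hint := integral_lt_integral_of_le_of_lt (ν := μ.map Prod.fst) (T := univ)
    ((hℓ.integrable_minLoss hum huB).add (hℓ.integrable_minLoss hnum hnuB))
    (integrable_zero (Input d) ℝ _) (fun x => (hℓ.minLoss_add_minLoss_neg_lt (hne x)).le)
    (by simp) (fun x _ => hℓ.minLoss_add_minLoss_neg_lt (hne x))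
  rw [integral_add' (hℓ.integrable_minLoss hum huB) (hℓ.integrable_minLoss hnum hnuB)] at hint
  simp only [Pi.zero_apply, integral_zero] at hint
  have hrisk : ∀ f : Input d → ℝ, Measurable f →
      ∫ x, weightedLoss ℓ (u x) (f x) ∂(μ.map Prod.fst) =
        ∫ z in Q, clampLoss ℓ (f z.1) z.2 ∂μ - r * ∫ z, clampLoss ℓ (f z.1) z.2 ∂μ := by
    intro f hf
    have h1 := hμ.setIntegral_loss_eq hX hℓ MeasurableSet.univ hf
    rw [Measure.restrict_univ] at h1
    rw [hμ.setIntegral_loss_eq hX hℓ hQ hf, h1, ← integral_const_mul, ← integral_sub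
      (hℓ.integrable_weightedLoss hmQ (hμ.norm_labelWeights_le Q) hf)
      ((hℓ.integrable_weightedLoss hmU (hμ.norm_labelWeights_le univ) hf).const_mul r)]
    refine integral_congr_ae (Eventually.of_forall fun x => ?_)
    simp only [u, weightedLoss, Prod.fst_sub, Prod.smul_fst, Prod.snd_sub, Prod.smul_snd,
      smul_eq_mul]
    ring
  rcases lt_or_ge (∫ x, minLoss ℓ (u x) ∂(μ.map Prod.fst)) 0 with h | h
  · obtain ⟨f, hfc, hf01, hf⟩ := hℓ.exists_continuous_integral_lt hum huB h
    refine ⟨f, hfc, hf01, fun heq => ?_⟩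
    rw [hrisk f hfc.measurable, heq, sub_self] at hf
    exact hf.false
  · obtain ⟨f, hfc, hf01, hf⟩ := hℓ.exists_continuous_integral_lt hnum hnuB
      (show ∫ x, minLoss ℓ (-u x) ∂(μ.map Prod.fst) < 0 by linarith)
    refine ⟨f, hfc, hf01, fun heq => ?_⟩
    have h1 : ∀ x, weightedLoss ℓ (-u x) (f x) = -weightedLoss ℓ (u x) (f x) := fun x => by
      simp only [weightedLoss, Prod.fst_neg, Prod.snd_neg]; ring
    simp only [h1] at hf
    rw [integral_neg, hrisk f hfc.measurable, heq, sub_self] at hf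
    simp at hf

/-- If the score depends on the labels, some threshold keeps only one of the labels near some
input where both labels occur. Then the full and the conditioned risk have no common nearly optimal
prediction. -/
lemma DependsOnLabels.exists_threshold (hX : IsCompact X) (hμ : IsBinaryProcess X μ p)
    (hℓ : IsClassificationLoss ℓ) (hg : IsAdapted X g) (hdep : DependsOnLabels μ p g) :
    ∃ c, μ.real {z | (dataSpace X).indicator g z ≤ c} ∈ Ioo (0 : ℝ) 1 ∧
      ∫ x, minLoss ℓ (labelWeights X p univ x) ∂(μ.map Prod.fst) +
        ∫ x, minLoss ℓ (labelWeights X p {z | (dataSpace X).indicator g z ≤ c} x)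
          ∂(μ.map Prod.fst) <
      ∫ x, minLoss ℓ (labelWeights X p univ x +
        labelWeights X p {z | (dataSpace X).indicator g z ≤ c} x) ∂(μ.map Prod.fst) := by
  have hprob : IsProbabilityMeasure (μ.map Prod.fst) :=
    Measure.isProbabilityMeasure_map measurable_fst.aemeasurable
  have hG := hg.measurable_indicator hX
  have hXm := hX.isClosed.measurableSet
  obtain ⟨x, -, hgne, hpx, hs0, hs1⟩ := hdep
  have hDc := (isCompact_dataSpace hX).isClosed
  have hx : x ∈ X := (Measure.support_subset_of_isClosed hDc hμ.ae_mem hs0).1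
  have hcont : ∀ y : ℝ, y = 0 ∨ y = 1 → ContinuousWithinAt (fun x' => g (x', y)) X x := by
    intro y hy
    have hmaps : MapsTo (fun x' : Input d => (x', y)) X (dataSpace X) := fun x' hx' => ⟨hx', hy⟩
    exact (hg.1 (x, y) (hmaps hx)).comp (f := fun x' : Input d => (x', y))
      (by fun_prop) hmaps
  obtain ⟨c, hc⟩ : ∃ c, g (x, 0) < c ∧ c < g (x, 1) ∨ g (x, 1) < c ∧ c < g (x, 0) := by
    rcases lt_or_gt_of_ne hgne with h | h
    · obtain ⟨c, h1, h2⟩ := exists_between h; exact ⟨c, Or.inl ⟨h1, h2⟩⟩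
    · obtain ⟨c, h1, h2⟩ := exists_between h; exact ⟨c, Or.inr ⟨h1, h2⟩⟩
  obtain ⟨U, hU, hxU, hUp, hUg⟩ : ∃ U, IsOpen U ∧ x ∈ U ∧ (∀ x' ∈ U ∩ X, p x' < 1) ∧
      ((∀ x' ∈ U ∩ X, g (x', 0) < c ∧ c < g (x', 1)) ∨
        ∀ x' ∈ U ∩ X, g (x', 1) < c ∧ c < g (x', 0)) := by
    rcases hc with ⟨h1, h2⟩ | ⟨h1, h2⟩
    · obtain ⟨U, hU, hxU, hUX⟩ := mem_nhdsWithin.1 ((hμ.usc x hx 1 hpx.2).and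
        (((hcont 0 (Or.inl rfl)).eventually_lt_const h1).and
          ((hcont 1 (Or.inr rfl)).eventually_const_lt h2)))
      exact ⟨U, hU, hxU, fun x' hx' => (hUX hx').1, Or.inl fun x' hx' => (hUX hx').2⟩
    · obtain ⟨U, hU, hxU, hUX⟩ := mem_nhdsWithin.1 ((hμ.usc x hx 1 hpx.2).and
        (((hcont 1 (Or.inr rfl)).eventually_lt_const h1).and
          ((hcont 0 (Or.inl rfl)).eventually_const_lt h2)))
      exact ⟨U, hU, hxU, fun x' hx' => (hUX hx').1, Or.inr fun x' hx' => (hUX hx').2⟩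
  have hmeas : ∀ y : ℝ, y = 0 ∨ y = 1 → (x, y) ∈ μ.support → μ ((U ∩ X) ×ˢ ({y} : Set ℝ)) ≠ 0 := by
    intro y hy hs
    have hn : U ×ˢ Ioo (y - 1) (y + 1) ∈ 𝓝 (x, y) :=
      prod_mem_nhds (hU.mem_nhds hxU) (Ioo_mem_nhds (by linarith) (by linarith))
    have h1 := (Measure.mem_support_iff_forall _).1 hs _ hn
    intro h0
    refine h1.ne' ?_
    rw [← nonpos_iff_eq_zero, ← h0]
    refine measure_mono_ae ?_
    filter_upwards [hμ.ae_mem] with z hz hzU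
    obtain ⟨hzU1, hz1, hz2⟩ := hzU
    refine ⟨⟨hzU1, hz.1⟩, ?_⟩
    have h2 : z.2 = 0 ∨ z.2 = 1 := hz.2
    rw [mem_singleton_iff]
    rcases h2 with h | h <;> rcases hy with rfl | rfl
    · exact h
    · norm_num [h] at hz1
    · norm_num [h] at hz2
    · exact h
  have hm0 := hmeas 0 (Or.inl rfl) hs0
  have hm1 := hmeas 1 (Or.inr rfl) hs1
  set Q : Set (Sample d) := {z | (dataSpace X).indicator g z ≤ c} with hQ
  have hQm : MeasurableSet Q := measurableSet_le hG measurable_const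
  have hQiff : ∀ x' ∈ X, ∀ y : ℝ, y = 0 ∨ y = 1 → ((x', y) ∈ Q ↔ g (x', y) ≤ c) :=
    fun x' hx' y hy => by
      rw [hQ, mem_ofPred_eq, indicator_of_mem (show (x', y) ∈ dataSpace X from ⟨hx', hy⟩)]
  -- near `x` the set `Q` contains exactly one of the two labels
  have hside : (∀ x' ∈ U ∩ X, (x', (0 : ℝ)) ∈ Q ∧ (x', (1 : ℝ)) ∉ Q) ∨
      (∀ x' ∈ U ∩ X, (x', (1 : ℝ)) ∈ Q ∧ (x', (0 : ℝ)) ∉ Q) := by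
    refine hUg.imp (fun h x' hx' => ?_) fun h x' hx' => ?_ <;>
      rw [hQiff x' hx'.2 0 (Or.inl rfl), hQiff x' hx'.2 1 (Or.inr rfl), not_le]
    · exact ⟨(h x' hx').1.le, (h x' hx').2⟩
    · exact ⟨(h x' hx').1.le, (h x' hx').2⟩
  have hr : μ.real Q ∈ Ioo (0 : ℝ) 1 := by
    refine measureReal_mem_Ioo hQm ?_ ?_ <;> rcases hside with h | h
    · exact fun h0 => hm0 (measure_mono_null (by rintro ⟨x', y⟩ ⟨h1, rfl⟩; exact (h x' h1).1) h0)
    · exact fun h0 => hm1 (measure_mono_null (by rintro ⟨x', y⟩ ⟨h1, rfl⟩; exact (h x' h1).1) h0)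
    · exact fun h0 => hm1 (measure_mono_null (by rintro ⟨x', y⟩ ⟨h1, rfl⟩; exact (h x' h1).2) h0)
    · exact fun h0 => hm0 (measure_mono_null (by rintro ⟨x', y⟩ ⟨h1, rfl⟩; exact (h x' h1).2) h0)
  refine ⟨c, hr, ?_⟩
  have hmU := hμ.measurable_labelWeights hX MeasurableSet.univ
  have hmQ := hμ.measurable_labelWeights hX hQm
  have hBU := hμ.norm_labelWeights_le (univ : Set (Sample d))
  have hBQ := hμ.norm_labelWeights_le Q
  have hiU := hℓ.integrable_minLoss (ν := μ.map Prod.fst) hmU hBU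
  have hiQ := hℓ.integrable_minLoss (ν := μ.map Prod.fst) hmQ hBQ
  rw [← integral_add hiU hiQ]
  refine integral_lt_integral_of_le_of_lt (T := {x' ∈ U ∩ X | 0 < p x'}) (hiU.add hiQ)
    (hℓ.integrable_minLoss (hmU.add hmQ) (B := 2) fun x' =>
      (norm_add_le _ _).trans (by linarith [hBU x', hBQ x']))
      (fun x' => hℓ.minLoss_add_le _ _) ?_ ?_
  · intro h0
    refine hm1 ?_
    have h1 := hμ.condProb (U ∩ X) (hU.measurableSet.inter hXm)
    rw [setIntegral_eq_zero_of_ae_eq_zero] at h1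
    · exact (measureReal_eq_zero_iff).1 h1
    · filter_upwards [measure_eq_zero_iff_ae_notMem.1 h0] with x' hx' hx'U
      refine le_antisymm (not_lt.1 fun h => hx' ⟨hx'U, h⟩) (hμ.mem_Icc x' hx'U.2).1
  · rintro x' ⟨hx'U, hp0⟩
    have hp1 := hUp x' hx'U
    have hU' : labelWeights X p univ x' = (1 - p x', p x') := by
      simp [labelWeights, indicator_of_mem hx'U.2]
    rw [hU']
    refine hℓ.minLoss_add_lt ⟨hp0, hp1⟩ ?_
    rcases hside with h | h <;> obtain ⟨h1, h2⟩ := h x' hx'U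
    · left; simp [labelWeights, indicator_of_mem hx'U.2, h1, h2]
    · right; simp [labelWeights, indicator_of_mem hx'U.2, h1, h2]

end Threshold

/-! ### Compactness of the parameter space -/

/-- The entries of the parameters of a network, as an element of a finite-dimensional normed
space. -/
abbrev ParamSpace (d H K : ℕ) : Type :=
  (Fin K → Fin d → ℝ) × (Fin K → ℝ) × (Fin (H - 1) → Fin K → Fin K → ℝ) ×
    (Fin (H - 1) → Fin K → ℝ) × (Fin K → ℝ) × ℝ

section Params

variable {d H K : ℕ} {σ : ℝ → ℝ}

/-- The network with the given parameters. -/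
def ParamSpace.toNet (θ : ParamSpace d H K) : NetParams d H K :=
  ⟨θ.1, θ.2.1, θ.2.2.1, θ.2.2.2.1, θ.2.2.2.2.1, θ.2.2.2.2.2⟩

/-- The parameters of the given network. -/
def NetParams.toParams (w : NetParams d H K) : ParamSpace d H K :=
  (w.inW, w.inB, w.hidW, w.hidB, w.outW, w.outB)

lemma ParamSpace.boundedBy_toNet_iff {θ : ParamSpace d H K} {R : ℝ} (hR : 0 ≤ R) :
    θ.toNet.BoundedBy R ↔ θ ∈ Metric.closedBall 0 R := by
  simp only [mem_closedBall_zero_iff, norm_prod_le_iff, pi_norm_le_iff_of_nonneg hR,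
    Real.norm_eq_abs]
  rfl

lemma continuous_hidden (hσ : Continuous σ) (i : ℕ) :
    Continuous fun q : ParamSpace d H K × Input d => q.1.toNet.hidden σ q.2 i := by
  induction i with
  | zero =>
    refine continuous_pi fun k => hσ.comp ?_
    simp only [ParamSpace.toNet, Matrix.mulVec, dotProduct]
    refine Continuous.add (continuous_finsetSum _ fun j _ => ?_) (by fun_prop)
    exact Continuous.mul (by fun_prop)
      ((EuclideanSpace.proj (𝕜 := ℝ) j).continuous.comp continuous_snd)
  | succ i ih =>
    simp only [NetParams.hidden]
    split_ifs with h
    · refine continuous_pi fun k => hσ.comp ?_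
      have ih' := fun j => (continuous_apply j).comp ih
      simp only [Function.comp_def] at ih'
      simp only [ParamSpace.toNet, Matrix.mulVec, dotProduct] at ih' ⊢
      refine Continuous.add (continuous_finsetSum _ fun j _ => ?_) (by fun_prop)
      exact Continuous.mul (by fun_prop) (ih' j)
    · exact ih

lemma continuous_eval (hσ : Continuous σ) :
    Continuous fun q : ParamSpace d H K × Input d => q.1.toNet.eval σ q.2 := by
  have ih' := fun j => (continuous_apply j).comp
    (continuous_hidden (d := d) (H := H) (K := K) hσ (H - 1))
  simp only [Function.comp_def] at ih'
  simp only [NetParams.eval]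
  refine Continuous.add (continuous_finsetSum _ fun j _ => Continuous.mul ?_ (ih' j)) ?_ <;>
    simp only [ParamSpace.toNet] <;> fun_prop

lemma NetParams.continuous_eval (hσ : Continuous σ) (w : NetParams d H K) :
    Continuous fun x => w.eval σ x :=
  (DataPruning.continuous_eval hσ).comp (Continuous.prodMk_right w.toParams)

/-- The loss of a network as a continuous function on the data space. -/
def netLoss {ℓ : ℝ → ℝ → ℝ} (hℓ : IsClassificationLoss ℓ) (hσ : Continuous σ) (X : Set (Input d))
    (θ : ParamSpace d H K) : C(dataSpace X, ℝ) :=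
  ⟨fun z => clampLoss ℓ (θ.toNet.eval σ z.1.1) z.1.2, by
    exact hℓ.continuous_clampLoss.comp
      ((((continuous_eval hσ).comp (Continuous.prodMk_right θ)).comp
        (continuous_fst.comp continuous_subtype_val)).prodMk
        (continuous_snd.comp continuous_subtype_val))⟩

lemma continuous_netLoss {ℓ : ℝ → ℝ → ℝ} (hℓ : IsClassificationLoss ℓ) (hσ : Continuous σ)
    (X : Set (Input d)) : Continuous (netLoss (H := H) (K := K) hℓ hσ X) := by
  refine ContinuousMap.continuous_of_continuous_uncurry _ ?_
  exact hℓ.continuous_clampLoss.comp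
    (((continuous_eval hσ).comp (continuous_fst.prodMk
      (continuous_fst.comp (continuous_subtype_val.comp continuous_snd)))).prodMk
      (continuous_snd.comp (continuous_subtype_val.comp continuous_snd)))

end Params

/-! ### Risks of networks -/

section Risk

variable {d H K : ℕ} {X : Set (Input d)} {μ : Measure (Sample d)}
  {p : Input d → ℝ} {g : Sample d → ℝ} {A : Finset (Sample d) → ℝ → Finset (Sample d)}
  {σ : ℝ → ℝ} {ℓ : ℝ → ℝ → ℝ} {R : ℝ}

lemma netLoss_apply (hℓ : IsClassificationLoss ℓ) (hσ : Continuous σ)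
    {w : NetParams d H K} (hw : w ∈ ffnnParams X σ H K R) {z : Sample d} (hz : z ∈ dataSpace X) :
    extendData (netLoss hℓ hσ X w.toParams) z = ℓ (w.eval σ z.1) z.2 := by
  rw [extendData_apply _ hz]
  refine clampLoss_of_mem ℓ (hw.2 _ hz.1) ?_
  have h : z.2 = 0 ∨ z.2 = 1 := hz.2
  rcases h with h | h <;> simp [h]

lemma setIntegral_netLoss (hμ : IsBinaryProcess X μ p) (hℓ : IsClassificationLoss ℓ)
    (hσ : Continuous σ) (w : NetParams d H K) (Q : Set (Sample d)) :
    ∫ z in Q, extendData (netLoss hℓ hσ X w.toParams) z ∂μ =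
      ∫ z in Q, clampLoss ℓ (w.eval σ z.1) z.2 ∂μ := by
  refine integral_congr_ae (ae_restrict_of_ae ?_)
  filter_upwards [hμ.ae_mem] with z hz
  rw [extendData_apply _ hz]
  rfl

lemma risk_eq (hμ : IsBinaryProcess X μ p) (hℓ : IsClassificationLoss ℓ)
    (hσ : Continuous σ) {w : NetParams d H K} (hw : w ∈ ffnnParams X σ H K R) :
    risk ℓ μ (w.eval σ) = ∫ z, extendData (netLoss hℓ hσ X w.toParams) z ∂μ := by
  refine integral_congr_ae ?_
  filter_upwards [hμ.ae_mem] with z hz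
  rw [netLoss_apply hℓ hσ hw hz]

lemma prunedRisk_eq (hA : IsPruningAlgorithm X A) (hℓ : IsClassificationLoss ℓ)
    (hσ : Continuous σ) {w : NetParams d H K} (hw : w ∈ ffnnParams X σ H K R) {r : ℝ}
    (hr : r ∈ Ioc (0 : ℝ) 1) {ω : ℕ → Sample d} (hω : ∀ i, ω i ∈ dataSpace X) (n : ℕ) :
    prunedRisk ℓ A r ω n (w.eval σ) =
      sampleAverage (A (firstSamples ω n) r) (extendData (netLoss hℓ hσ X w.toParams)) := by
  have hsub : (firstSamples ω n : Set (Sample d)) ⊆ dataSpace X := fun z hz => by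
    classical
    obtain ⟨i, -, rfl⟩ := Finset.mem_image.1 (Finset.mem_coe.1 hz)
    exact hω i
  rw [prunedRisk, empiricalRisk, sampleAverage]
  congr 1
  refine Finset.sum_congr rfl fun z hz => ?_
  rw [netLoss_apply hℓ hσ hw (hsub ((hA _ hsub r hr).1 hz))]

/-- The families `FFNN_{H,K}(R)` contain networks whose risks, also after restriction to `Q`, are
close to those of a given continuous prediction. -/
lemma exists_ffnnParams_risk_approx [IsProbabilityMeasure μ] (hd : 1 ≤ d) (hX : IsCompact X)
    (hK : d + 2 ≤ K)
    (hσ : IsAdmissibleActivation σ) (hμ : IsBinaryProcess X μ p) (hℓ : IsClassificationLoss ℓ)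
    {f : Input d → ℝ} (hf : Continuous f) (hf01 : ∀ x, f x ∈ Icc (0 : ℝ) 1) {δ : ℝ}
    (hδ : 0 < δ) :
    ∃ (R₀ : ℝ) (H₀ : ℕ), ∀ H ≥ H₀, ∀ R ≥ R₀, ∃ w ∈ ffnnParams X σ H K R,
      ∀ Q : Set (Sample d), |∫ z in Q, clampLoss ℓ (w.eval σ z.1) z.2 ∂μ -
        ∫ z in Q, clampLoss ℓ (f z.1) z.2 ∂μ| ≤ δ := by
  have huc := ((isCompact_Icc (a := (0 : ℝ)) (b := 1)).prod
    (isCompact_Icc (a := (0 : ℝ)) (b := 1))).uniformContinuousOn_of_continuous hℓ.continuousOn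
  obtain ⟨ε, hε, hεδ⟩ := Metric.uniformContinuousOn_iff.1 huc δ hδ
  obtain ⟨R₀, H₀, h⟩ := exists_ffnnParams_approx hd hX hK hσ hf hf01 (half_pos hε)
  refine ⟨R₀, H₀, fun H hH R hR => ?_⟩
  obtain ⟨w, hw, hwf⟩ := h H hH R hR
  refine ⟨w, hw, fun Q => ?_⟩
  obtain ⟨C, -, hC⟩ := hℓ.exists_bound
  have hint : ∀ f : Input d → ℝ, Continuous f →
      Integrable (fun z : Sample d => clampLoss ℓ (f z.1) z.2) (μ.restrict Q) := fun f hf =>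
    Integrable.of_bound (hℓ.continuous_clampLoss.comp
      ((hf.comp continuous_fst).prodMk continuous_snd)).aestronglyMeasurable C
      (Eventually.of_forall fun z => hC _ _)
  rw [← integral_sub (hint _ (w.continuous_eval hσ.continuous)) (hint f hf)]
  have h1 : ∀ᵐ z ∂(μ.restrict Q),
      ‖clampLoss ℓ (w.eval σ z.1) z.2 - clampLoss ℓ (f z.1) z.2‖ ≤ δ := by
    refine ae_restrict_of_ae ?_
    filter_upwards [hμ.ae_mem] with z hz
    have hz2 : z.2 ∈ Icc (0 : ℝ) 1 := by
      have h : z.2 = 0 ∨ z.2 = 1 := hz.2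
      rcases h with h | h <;> simp [h]
    rw [clampLoss_of_mem ℓ (hw.2 _ hz.1) hz2, clampLoss_of_mem ℓ (hf01 _) hz2]
    refine (hεδ (w.eval σ z.1, z.2) ⟨hw.2 _ hz.1, hz2⟩ (f z.1, z.2) ⟨hf01 _, hz2⟩ ?_).le
    rw [Prod.dist_eq, dist_self, max_eq_left dist_nonneg, Real.dist_eq]
    exact (hwf _ hz.1).trans_lt (half_lt_self hε)
  refine (norm_integral_le_of_norm_le_const h1).trans (mul_le_of_le_one_right hδ.le ?_)
  rw [measureReal_restrict_apply_univ]
  exact measureReal_le_one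

lemma tendsto_setIntegral_extendData [IsProbabilityMeasure μ] (hX : IsCompact X)
    {φ : ℕ → C(dataSpace X, ℝ)}
    {φ' : C(dataSpace X, ℝ)} (h : Tendsto φ atTop (𝓝 φ')) (Q : Set (Sample d)) :
    Tendsto (fun n => ∫ z in Q, extendData (φ n) z ∂μ) atTop
      (𝓝 (∫ z in Q, extendData φ' z ∂μ)) := by
  have : CompactSpace (dataSpace X) := isCompact_iff_compactSpace.1 (isCompact_dataSpace hX)
  rw [tendsto_iff_norm_sub_tendsto_zero] at h ⊢
  exact squeeze_zero (fun _ => norm_nonneg _)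
    (fun n => abs_setIntegral_extendData_sub_le hX _ _ Q) h

/-- If exact training on the pruned samples is valid, then by compactness some network minimizes
both the risk and the risk restricted to the samples kept in the limit. -/
lemma exists_common_minimizer [IsProbabilityMeasure μ] (hX : IsCompact X) (hσ : Continuous σ)
    (hℓ : IsClassificationLoss ℓ) (hμ : IsBinaryProcess X μ p) (hA : IsPruningAlgorithm X A)
    (hg : IsAdapted X g) (hAg : IsScoreBased X g A) {c : ℝ}
    (hr01 : μ.real {z | (dataSpace X).indicator g z ≤ c} ∈ Ioo (0 : ℝ) 1) (hR : 0 ≤ R)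
    {train : ℝ → ℕ → (ℕ → Sample d) → NetParams d H K}
    (htrain : IsExactTraining ℓ μ (NetParams.eval σ) (ffnnParams X σ H K R) A train)
    (hvalid : IsValid ℓ μ (NetParams.eval σ) (ffnnParams X σ H K R) train) :
    ∃ w : NetParams d H K, ∀ w' ∈ ffnnParams X σ H K R,
      ∫ z, clampLoss ℓ (w.eval σ z.1) z.2 ∂μ ≤ ∫ z, clampLoss ℓ (w'.eval σ z.1) z.2 ∂μ ∧
      ∫ z in {z | (dataSpace X).indicator g z ≤ c}, clampLoss ℓ (w.eval σ z.1) z.2 ∂μ ≤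
        ∫ z in {z | (dataSpace X).indicator g z ≤ c}, clampLoss ℓ (w'.eval σ z.1) z.2 ∂μ := by
  have hDcomp : CompactSpace (dataSpace X) :=
    isCompact_iff_compactSpace.1 (isCompact_dataSpace hX)
  set Q : Set (Sample d) := {z | (dataSpace X).indicator g z ≤ c} with hQ
  obtain ⟨r, hr⟩ : ∃ r, r = μ.real Q := ⟨_, rfl⟩
  rw [← hr] at hr01
  have hrI : r ∈ Ioc (0 : ℝ) 1 := ⟨hr01.1, hr01.2.le⟩
  have hprob : IsProbabilityMeasure (iidLaw μ) := by unfold iidLaw; infer_instance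
  obtain ⟨ω, hω1, hω2, hω3, hωD⟩ := ((ae_forall_tendsto_pruned_average hX hμ hA hg hAg hr hr01).and
    ((htrain r hrI).and ((hvalid r hrI).and (ae_iidLaw_forall hμ.ae_mem)))).exists
  let θ : ℕ → ParamSpace d H K := fun n => (train r n ω).toParams
  have hθ : ∀ n, θ n ∈ Metric.closedBall (0 : ParamSpace d H K) R := fun n =>
    (ParamSpace.boundedBy_toNet_iff hR).1 (hω2 n).1.1
  obtain ⟨θ', -, ns, hns, hlim⟩ := (isCompact_closedBall (0 : ParamSpace d H K) R).tendsto_subseq hθ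
  have hloss : Tendsto (fun j => netLoss hℓ hσ X (θ (ns j))) atTop (𝓝 (netLoss hℓ hσ X θ')) :=
    ((continuous_netLoss hℓ hσ X).tendsto θ').comp hlim
  set Φ := netLoss hℓ hσ X θ' with hΦ
  refine ⟨θ'.toNet, fun w' hw' => ?_⟩
  have hset := fun (w : NetParams d H K) Q => setIntegral_netLoss hμ hℓ hσ w Q
  have huniv := fun w : NetParams d H K => hset w univ
  simp only [Measure.restrict_univ] at huniv
  -- by validity the trained risks tend to the infimum of the risk
  have hfull : ∫ z, extendData Φ z ∂μ ≤ ∫ z, extendData (netLoss hℓ hσ X w'.toParams) z ∂μ := by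
    have h1 : Tendsto (fun j => ∫ z, extendData (netLoss hℓ hσ X (θ (ns j))) z ∂μ) atTop
        (𝓝 (∫ z, extendData Φ z ∂μ)) := by
      simpa only [Measure.restrict_univ] using
        tendsto_setIntegral_extendData (μ := μ) hX hloss univ
    have h2 := (hω3.comp hns.tendsto_atTop).add_const
      (sInf ((fun w => risk ℓ μ (w.eval σ)) '' ffnnParams X σ H K R))
    simp only [Function.comp_def, sub_add_cancel, zero_add] at h2
    have h3 : ∀ j, risk ℓ μ ((train r (ns j) ω).eval σ) =
        ∫ z, extendData (netLoss hℓ hσ X (θ (ns j))) z ∂μ := fun j =>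
      risk_eq hμ hℓ hσ (hω2 (ns j)).1
    simp only [h3] at h2
    rw [tendsto_nhds_unique h1 h2, ← risk_eq hμ hℓ hσ hw']
    refine csInf_le ⟨0, ?_⟩ ⟨w', hw', rfl⟩
    rintro _ ⟨w, hw, rfl⟩
    refine integral_nonneg_of_ae ?_
    filter_upwards [hμ.ae_mem] with z hz
    rw [← netLoss_apply hℓ hσ hw hz, extendData_apply _ hz]
    exact hℓ.clampLoss_nonneg _ _
  -- each trained network is at least as good as `w'` on the pruned samples, and the losses of
  -- the trained networks converge uniformly, so that both sides pass to the limit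
  have hpruned : ∫ z in Q, extendData Φ z ∂μ ≤
      ∫ z in Q, extendData (netLoss hℓ hσ X w'.toParams) z ∂μ := by
    have h1 : Tendsto (fun j => sampleAverage (A (firstSamples ω (ns j)) r)
        (extendData (netLoss hℓ hσ X (θ (ns j))))) atTop
        (𝓝 ((∫ z in Q, extendData Φ z ∂μ) / r)) := by
      have h2 : Tendsto (fun j => sampleAverage (A (firstSamples ω (ns j)) r)
          (extendData (netLoss hℓ hσ X (θ (ns j)))) -
          sampleAverage (A (firstSamples ω (ns j)) r) (extendData Φ)) atTop (𝓝 0) := by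
        refine squeeze_zero_norm (fun j => ?_) (tendsto_iff_norm_sub_tendsto_zero.1 hloss)
        refine abs_sampleAverage_sub_le (norm_nonneg _) fun z _ => ?_
        rw [extendData_sub]
        exact abs_extendData_le _ z
      simpa using h2.add ((hω1 Φ).comp hns.tendsto_atTop)
    have h2 := (hω1 (netLoss hℓ hσ X w'.toParams)).comp hns.tendsto_atTop
    have h3 := le_of_tendsto_of_tendsto' h1 h2 fun j => by
      have h4 := (hω2 (ns j)).2 w' hw'
      rw [prunedRisk_eq hA hℓ hσ (hω2 (ns j)).1 hrI hωD,
        prunedRisk_eq hA hℓ hσ hw' hrI hωD] at h4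
      exact h4
    exact (div_le_div_iff_of_pos_right hr01.1).1 h3
  rw [huniv] at hfull
  rw [hset] at hpruned
  exact ⟨(huniv θ'.toNet).symm.trans_le hfull, (hset θ'.toNet Q).symm.trans_le hpruned⟩

end Risk

/-! ### Failure of consistency and of validity -/

section Failure

variable {d H K : ℕ} {X : Set (Input d)} {μ : Measure (Sample d)} [IsProbabilityMeasure μ]
  {p : Input d → ℝ} {g : Sample d → ℝ} {A : Finset (Sample d) → ℝ → Finset (Sample d)}
  {σ : ℝ → ℝ} {ℓ : ℝ → ℝ → ℝ} {R : ℝ}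

/-- Consistency forces the average loss of each network over the samples kept in the limit to be its
average loss over all samples. -/
lemma IsConsistent.setIntegral_eq (hX : IsCompact X) (hσ : Continuous σ)
    (hℓ : IsClassificationLoss ℓ) (hμ : IsBinaryProcess X μ p) (hA : IsPruningAlgorithm X A)
    (hg : IsAdapted X g) (hAg : IsScoreBased X g A) {c : ℝ}
    (hr : μ.real {z | (dataSpace X).indicator g z ≤ c} ∈ Ioo (0 : ℝ) 1)
    (hcons : IsConsistent ℓ μ (NetParams.eval σ) (ffnnParams X σ H K R) A)
    {w : NetParams d H K} (hw : w ∈ ffnnParams X σ H K R) :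
    ∫ z in {z | (dataSpace X).indicator g z ≤ c}, clampLoss ℓ (w.eval σ z.1) z.2 ∂μ =
      μ.real {z | (dataSpace X).indicator g z ≤ c} *
        ∫ z, clampLoss ℓ (w.eval σ z.1) z.2 ∂μ := by
  set Q : Set (Sample d) := {z | (dataSpace X).indicator g z ≤ c} with hQ
  have hrI : μ.real Q ∈ Ioc (0 : ℝ) 1 := ⟨hr.1, hr.2.le⟩
  have hprob : IsProbabilityMeasure (iidLaw μ) := by unfold iidLaw; infer_instance
  obtain ⟨ω, hω1, hω2, hωD⟩ := ((ae_forall_tendsto_pruned_average hX hμ hA hg hAg rfl hr).and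
    ((hcons _ hrI w hw).and (ae_iidLaw_forall hμ.ae_mem))).exists
  have hrisk : risk ℓ μ (w.eval σ) = ∫ z, clampLoss ℓ (w.eval σ z.1) z.2 ∂μ := by
    rw [risk_eq hμ hℓ hσ hw]
    simpa only [Measure.restrict_univ] using setIntegral_netLoss hμ hℓ hσ w univ
  have h1 := hω1 (netLoss hℓ hσ X w.toParams)
  simp only [prunedRisk_eq hA hℓ hσ hw hrI hωD, hrisk] at hω2
  have h2 := tendsto_nhds_unique h1 hω2
  rw [setIntegral_netLoss hμ hℓ hσ w, div_eq_iff hr.1.ne'] at h2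
  rw [h2, mul_comm]

/-- A network close to a prediction whose average losses over `Q` and over all samples differ
violates consistency at the level `μ Q`. -/
theorem exists_forall_not_isConsistent (hX : IsCompact X) (hK : d + 2 ≤ K)
    (hσ : IsAdmissibleActivation σ) (hℓ : IsClassificationLoss ℓ) (hμ : IsBinaryProcess X μ p)
    (hA : IsPruningAlgorithm X A) (hg : IsAdapted X g) (hAg : IsScoreBased X g A) :
    ∃ R₀ : ℝ, 0 < R₀ ∧ ∃ H₀ : ℕ, 1 ≤ H₀ ∧ ∀ H : ℕ, H₀ ≤ H → ∀ R : ℝ, R₀ ≤ R →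
      ¬ IsConsistent ℓ μ (NetParams.eval σ) (ffnnParams X σ H K R) A := by
  obtain ⟨c, hr⟩ := hg.exists_threshold hX hμ
  have hQm : MeasurableSet {z | (dataSpace X).indicator g z ≤ c} :=
    measurableSet_le (hg.measurable_indicator hX) measurable_const
  obtain ⟨f, hf, hf01, hne⟩ := hμ.exists_continuous_setIntegral_ne hX hℓ hQm hr
  set Q : Set (Sample d) := {z | (dataSpace X).indicator g z ≤ c} with hQ
  have hδ := abs_pos.2 (sub_ne_zero.2 hne)
  set D := ∫ z in Q, clampLoss ℓ (f z.1) z.2 ∂μ - μ.real Q * ∫ z, clampLoss ℓ (f z.1) z.2 ∂μ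
  obtain ⟨R₀, H₀, happ⟩ := exists_ffnnParams_risk_approx (hg.one_le_dim hX hμ) hX hK hσ hμ hℓ hf
    hf01 (show 0 < |D| / 3 by positivity)
  refine ⟨max R₀ 1, by positivity, max H₀ 1, le_max_right _ _, fun H hH R hR hcons => ?_⟩
  obtain ⟨w, hw, hwf⟩ := happ H ((le_max_left _ _).trans hH) R ((le_max_left _ _).trans hR)
  have heq := hcons.setIntegral_eq hX hσ.continuous hℓ hμ hA hg hAg hr hw
  have h1 := abs_le.1 (hwf Q)
  have h2 := hwf univ
  rw [Measure.restrict_univ] at h2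
  rw [heq] at h1
  have h3 : |μ.real Q * (∫ z, clampLoss ℓ (w.eval σ z.1) z.2 ∂μ -
      ∫ z, clampLoss ℓ (f z.1) z.2 ∂μ)| ≤ |D| / 3 := by
    rw [abs_mul, abs_of_pos hr.1]
    exact (mul_le_of_le_one_left (abs_nonneg _) hr.2.le).trans h2
  rw [mul_sub] at h3
  have h3' := abs_le.1 h3
  have h4 : |D| ≤ |D| / 3 + |D| / 3 := abs_le.2
    ⟨by simp only [D] at *; linarith [h1.1, h1.2, h3'.1, h3'.2],
      by simp only [D] at *; linarith [h1.1, h1.2, h3'.1, h3'.2]⟩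
  linarith

/-- Networks come close to the integral of the minimal loss, for the samples in `Q`. -/
lemma exists_ffnnParams_setIntegral_lt (hd : 1 ≤ d) (hX : IsCompact X) (hK : d + 2 ≤ K)
    (hσ : IsAdmissibleActivation σ) (hμ : IsBinaryProcess X μ p) (hℓ : IsClassificationLoss ℓ)
    {Q : Set (Sample d)} (hQ : MeasurableSet Q) {t : ℝ}
    (ht : ∫ x, minLoss ℓ (labelWeights X p Q x) ∂(μ.map Prod.fst) < t) :
    ∃ (R₀ : ℝ) (H₀ : ℕ), ∀ H ≥ H₀, ∀ R ≥ R₀, ∃ w ∈ ffnnParams X σ H K R,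
      ∫ z in Q, clampLoss ℓ (w.eval σ z.1) z.2 ∂μ < t := by
  have hprob : IsProbabilityMeasure (μ.map Prod.fst) :=
    Measure.isProbabilityMeasure_map measurable_fst.aemeasurable
  obtain ⟨f, hf, hf01, hft⟩ := hℓ.exists_continuous_integral_lt
    (hμ.measurable_labelWeights hX hQ) (hμ.norm_labelWeights_le Q) ht
  rw [← hμ.setIntegral_loss_eq hX hℓ hQ hf.measurable] at hft
  obtain ⟨R₀, H₀, happ⟩ := exists_ffnnParams_risk_approx hd hX hK hσ hμ hℓ hf hf01
    (half_pos (sub_pos.2 hft))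
  refine ⟨R₀, H₀, fun H hH R hR => ?_⟩
  obtain ⟨w, hw, hwf⟩ := happ H hH R hR
  exact ⟨w, hw, by linarith [(abs_le.1 (hwf Q)).2]⟩

/-- A common minimizer of the full and of the restricted risk would be nearly optimal for both,
which `DependsOnLabels.exists_threshold` excludes. -/
theorem exists_forall_not_isValid (hX : IsCompact X) (hK : d + 2 ≤ K)
    (hσ : IsAdmissibleActivation σ) (hℓ : IsClassificationLoss ℓ) (hμ : IsBinaryProcess X μ p)
    (hA : IsPruningAlgorithm X A) (hg : IsAdapted X g) (hAg : IsScoreBased X g A)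
    (hdep : DependsOnLabels μ p g) :
    ∃ R₀ : ℝ, 0 < R₀ ∧ ∃ H₀ : ℕ, 1 ≤ H₀ ∧ ∀ H : ℕ, H₀ ≤ H → ∀ R : ℝ, R₀ ≤ R →
      ∀ train : ℝ → ℕ → (ℕ → Sample d) → NetParams d H K,
        IsExactTraining ℓ μ (NetParams.eval σ) (ffnnParams X σ H K R) A train →
        ¬ IsValid ℓ μ (NetParams.eval σ) (ffnnParams X σ H K R) train := by
  have hprob : IsProbabilityMeasure (μ.map Prod.fst) :=
    Measure.isProbabilityMeasure_map measurable_fst.aemeasurable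
  have hd := hg.one_le_dim hX hμ
  obtain ⟨c, hr, hgap⟩ := hdep.exists_threshold hX hμ hℓ hg
  have hQm : MeasurableSet {z | (dataSpace X).indicator g z ≤ c} :=
    measurableSet_le (hg.measurable_indicator hX) measurable_const
  -- the levels `t₁` and `t₂` exceed the two minimal losses, and `t₁ + t₂` is below the joint one
  obtain ⟨t₁, ht₁, ht₁'⟩ := exists_between (lt_sub_iff_add_lt.2 hgap)
  obtain ⟨t₂, ht₂, ht₂'⟩ := exists_between (lt_sub_comm.1 ht₁')
  obtain ⟨R₁, H₁, h₁⟩ := exists_ffnnParams_setIntegral_lt (K := K) hd hX hK hσ hμ hℓ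
    MeasurableSet.univ ht₁
  obtain ⟨R₂, H₂, h₂⟩ := exists_ffnnParams_setIntegral_lt (K := K) hd hX hK hσ hμ hℓ hQm ht₂
  refine ⟨max 1 (max R₁ R₂), by positivity, max 1 (max H₁ H₂), le_max_left _ _,
    fun H hH R hR train htrain hvalid => ?_⟩
  simp only [max_le_iff] at hH hR
  obtain ⟨w₁, hw₁, hl₁⟩ := h₁ H hH.2.1 R hR.2.1
  obtain ⟨w₂, hw₂, hl₂⟩ := h₂ H hH.2.2 R hR.2.2
  rw [Measure.restrict_univ] at hl₁
  obtain ⟨w, hw⟩ := exists_common_minimizer hX hσ.continuous hℓ hμ hA hg hAg hr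
    (zero_le_one.trans hR.1) htrain hvalid
  -- `w` reaches both levels, hence its joint loss is below the minimal joint loss
  have hfull := (hw w₁ hw₁).1.trans_lt hl₁
  have hpruned := (hw w₂ hw₂).2.trans_lt hl₂
  set Q : Set (Sample d) := {z | (dataSpace X).indicator g z ≤ c} with hQ
  have hwm : Measurable fun x => w.eval σ x := (w.continuous_eval hσ.continuous).measurable
  have hmU := hμ.measurable_labelWeights hX MeasurableSet.univ
  have hmQ := hμ.measurable_labelWeights hX hQm
  have hBU := hμ.norm_labelWeights_le (univ : Set (Sample d))
  have hBQ := hμ.norm_labelWeights_le Q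
  have hB : ∀ x, ‖labelWeights X p univ x + labelWeights X p Q x‖ ≤ 2 := fun x =>
    (norm_add_le _ _).trans (by linarith [hBU x, hBQ x])
  rw [← Measure.restrict_univ (μ := μ), hμ.setIntegral_loss_eq hX hℓ MeasurableSet.univ hwm]
    at hfull
  rw [hμ.setIntegral_loss_eq hX hℓ hQm hwm] at hpruned
  have hlow := integral_mono (hℓ.integrable_minLoss (ν := μ.map Prod.fst) (hmU.add hmQ) hB)
    (hℓ.integrable_weightedLoss (hmU.add hmQ) hB hwm) fun x => hℓ.minLoss_le _ (w.eval σ x)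
  simp only [Pi.add_apply, weightedLoss_add] at hlow
  rw [integral_add (hℓ.integrable_weightedLoss hmU hBU hwm)
    (hℓ.integrable_weightedLoss hmQ hBQ hwm)] at hlow
  linarith

end Failure

end DataPruning

end

theorem mainTheorem11 {d : ℕ} {X : Set (DataPruning.Input d)} (hX : IsCompact X)
    {K : ℕ} (hK : d + 2 ≤ K)
    {σ : ℝ → ℝ} (hσ : DataPruning.IsAdmissibleActivation σ)
    {ℓ : ℝ → ℝ → ℝ} (hℓ : DataPruning.IsClassificationLoss ℓ)
    {μ : MeasureTheory.Measure (DataPruning.Sample d)} [MeasureTheory.IsProbabilityMeasure μ]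
    {p : DataPruning.Input d → ℝ} (hμ : DataPruning.IsBinaryProcess X μ p)
    {A : Finset (DataPruning.Sample d) → ℝ → Finset (DataPruning.Sample d)}
    (hA : DataPruning.IsPruningAlgorithm X A)
    {g : DataPruning.Sample d → ℝ} (hg : DataPruning.IsAdapted X g)
    (hAg : DataPruning.IsScoreBased X g A) :
    (∃ R₀ : ℝ, 0 < R₀ ∧ ∃ H₀ : ℕ, 1 ≤ H₀ ∧ ∀ H : ℕ, H₀ ≤ H → ∀ R : ℝ, R₀ ≤ R →
      ¬ DataPruning.IsConsistent ℓ μ (DataPruning.NetParams.eval σ)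
        (DataPruning.ffnnParams X σ H K R) A) ∧
    (DataPruning.DependsOnLabels μ p g →
      ∃ R₀' : ℝ, 0 < R₀' ∧ ∃ H₀' : ℕ, 1 ≤ H₀' ∧ ∀ H : ℕ, H₀' ≤ H → ∀ R : ℝ, R₀' ≤ R →
        ∀ train : ℝ → ℕ → (ℕ → DataPruning.Sample d) → DataPruning.NetParams d H K,
          DataPruning.IsExactTraining ℓ μ (DataPruning.NetParams.eval σ)
            (DataPruning.ffnnParams X σ H K R) A train →
          ¬ DataPruning.IsValid ℓ μ (DataPruning.NetParams.eval σ)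
            (DataPruning.ffnnParams X σ H K R) train) :=
  ⟨DataPruning.exists_forall_not_isConsistent hX hK hσ hℓ hμ hA hg hAg,
    DataPruning.exists_forall_not_isValid hX hK hσ hℓ hμ hA hg hAg⟩
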